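/- **Setting.** Let $\mathcal X\subset\mathbb R^d$ be bounded with diameter $R=\sup_{x,x'\in\mathcal X}\|x-x'\|_2$, and let $\mathcal D$ be a probability distribution on $\mathcal X\times\{-1,1\}$ for which $p_d=\Pr(y\ne y')>0$, where $(x,y),(x',y')$ are independent with law $\mathcal D$; put $p_s=\Pr(y=y')=1-p_d$. Let $T=((x_i,y_i))_{i=1}^n$, $n\ge 1$, be i.i.d. with law $\mathcal D$, let $x_{ij}=x_i-x_j$, and let $S$ and $D$ be the sets of ordered pairs $(i,j)$ with $y_i=y_j$ and with $y_i\neq y_j$, of sizes $n_s$ and $n_d$ ($n_s+n_d=n^2$; an average over the empty set is read as $0$). Let $M_1,\dots,M_N\in\mathbb R^{d\times d}$ be positive semidefinite source metrics, $\lambda>0$ and $b\in\mathbb R$. For a weight vector $\beta\in\mathbb R^N$ with $\beta\ge 0$ and $\|\beta\|_2\le 1$, a metric $M$ *learned* from $T$ with the weights $\beta$ is an optimal solution of $$\min_{M\succeq 0}\ \frac1{n_s}\sum_{(i,j)\in S}x_{ij}^\top M x_{ij}+\lambda\Big\|M-\sum_{j=1}^N\beta_jM_j\Big\|_F^2\quad\text{subject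 to}\quad \frac1{n_d}\sum_{(i,j)\in D}x_{ij}^\top Mx_{ij}\ge b$$ (in particular, this holds for every joint minimizer $(M,\beta)$ of this problem), and $\mu^\star\ge0$ denotes an optimal dual variable of the inequality constraint. Put $$L_T(M)=\frac1{n_s}\sum_{(i,j)\in S}x_{ij}^\top Mx_{ij}+\mu^\star\Big(b-\frac1{n_d}\sum_{(i,j)\in D}x_{ij}^\top Mx_{ij}\Big),$$ $$L_{\mathcal D}(M)=\mathbb E\big[(x-x')^\top M(x-x')\,\big|\,y=y'\big]+\mu^\star\Big(b-\mathbb E\big[(x-x')^\top M(x-x')\,\big|\,y\ne y'\big]\Big).$$ **Theorem.** There are absolute constants $K,C>0$ such that, in every such setting and for every $\delta\in(0,1)$, with probability at least $1-\delta$ over $T$ the following holds simultaneously for all $\beta\ge0$ with $\|\beta\|_2\le1$, all metrics $M$ learned from $T$ with the weights $\beta$ and all corresponding optimal dual variables $\mu^\star$: $L_T\big(\sum_j\beta_jM_j\big)\ge 0$ and $$L_{\mathcal D}(M)\le L_T(M)+K\,\frac{k^2}{\lambda n}+C\,\kappa\left(\sqrt{\frac{L_T\big(\sum_{j}\beta_jM_j\big)}{\lambda}}+\Big\|\sum_{j}\beta_jM_j\Big\|_F\right)\sqrt{\frac{\ln(2/\delta)}{2n}},$$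 where $k=\max\big(\tfrac1{p_s},\tfrac{\mu^\star}{p_d}\big)R^2$ and $\kappa=\big(\tfrac1{p_s}+\tfrac{\mu^\star}{p_d}\big)R^2$. If similar and dissimilar pairs are equally likely, then $k=2\max(1,\mu^\star)R^2$ and $\kappa=2(1+\mu^\star)R^2$. -/

import Mathlib

open MeasureTheory
open scoped Matrix BigOperators

-- `‖A‖` is the Frobenius norm of a real matrix `A`.
attribute [local instance] Matrix.frobeniusNormedAddCommGroup

namespace MetricTransfer

noncomputable section

/-- The label set `{-1, 1}`. -/
abbrev Label : Type := ({-1, 1} : Set ℤ)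

/-- The space of labelled examples `z = (x, y)`, with `x ∈ ℝ^d` and `y ∈ {-1, 1}`. -/
abbrev Example (d : ℕ) : Type := EuclideanSpace ℝ (Fin d) × Label

/-- The quadratic form `(x - x')ᵀ M (x - x')`, the squared distance of two feature vectors. -/
def sqDist {d : ℕ} (M : Matrix (Fin d) (Fin d) ℝ) (x x' : EuclideanSpace ℝ (Fin d)) : ℝ :=
  (x - x').ofLp ⬝ᵥ (M *ᵥ (x - x').ofLp)

/-- The index set `S` of the similar ordered pairs of a sample: equal labels, `y_i y_j = 1`. -/
def simPairs {d n : ℕ} (T : Fin n → Example d) : Finset (Fin n × Fin n) :=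
  Finset.univ.filter fun p => (T p.1).2 = (T p.2).2

/-- The index set `D` of the dissimilar ordered pairs of a sample: `y_i y_j = -1`. -/
def disPairs {d n : ℕ} (T : Fin n → Example d) : Finset (Fin n × Fin n) :=
  Finset.univ.filter fun p => (T p.1).2 ≠ (T p.2).2

/-- `(1 / n_s) ∑_{(i,j) ∈ S} x_ijᵀ M x_ij`. -/
def simAvg {d n : ℕ} (T : Fin n → Example d) (M : Matrix (Fin d) (Fin d) ℝ) : ℝ :=
  (∑ p ∈ simPairs T, sqDist M (T p.1).1 (T p.2).1) / ((simPairs T).card : ℝ)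

/-- `(1 / n_d) ∑_{(i,j) ∈ D} x_ijᵀ M x_ij`. -/
def disAvg {d n : ℕ} (T : Fin n → Example d) (M : Matrix (Fin d) (Fin d) ℝ) : ℝ :=
  (∑ p ∈ disPairs T, sqDist M (T p.1).1 (T p.2).1) / ((disPairs T).card : ℝ)

/-- The weighted source metric `∑_j β_j M_j`. -/
def weighted {d N : ℕ} (Ms : Fin N → Matrix (Fin d) (Fin d) ℝ)
    (β : EuclideanSpace ℝ (Fin N)) : Matrix (Fin d) (Fin d) ℝ :=
  ∑ j, β j • Ms j

/-- The admissible weight vectors: `β ≥ 0` and `‖β‖₂ ≤ 1`. -/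
def weightSet (N : ℕ) : Set (EuclideanSpace ℝ (Fin N)) :=
  {β | (∀ j, 0 ≤ β j) ∧ ‖β‖ ≤ 1}

/-- The admissible metrics: `(1 / n_d) ∑_{(i,j) ∈ D} x_ijᵀ M x_ij - b ≥ 0` and `M ⪰ 0`. -/
def feasible {d n : ℕ} (T : Fin n → Example d) (b : ℝ) : Set (Matrix (Fin d) (Fin d) ℝ) :=
  {M | disAvg T M - b ≥ 0 ∧ M.PosSemidef}

/-- The objective `(1 / n_s) ∑_{(i,j) ∈ S} x_ijᵀ M x_ij + λ ‖M - ∑_j β_j M_j‖_F²`. -/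
def objective {d n N : ℕ} (T : Fin n → Example d) (Ms : Fin N → Matrix (Fin d) (Fin d) ℝ)
    (lam : ℝ) (M : Matrix (Fin d) (Fin d) ℝ) (β : EuclideanSpace ℝ (Fin N)) : ℝ :=
  simAvg T M + lam * ‖M - weighted Ms β‖ ^ 2

/-- `M` is a metric learned from the sample `T` with the weight vector `β`: an optimal solution of
the transfer problem with the weights `β`. Every jointly optimal pair `(M, β)`, that is, every
minimizer of the objective over `feasible T b ×ˢ weightSet N`, has this property. -/
def IsLearned {d n N : ℕ} (T : Fin n → Example d) (Ms : Fin N → Matrix (Fin d) (Fin d) ℝ)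
    (lam b : ℝ) (β : EuclideanSpace ℝ (Fin N)) (M : Matrix (Fin d) (Fin d) ℝ) : Prop :=
  β ∈ weightSet N ∧ M ∈ feasible T b ∧
    ∀ M' ∈ feasible T b, objective T Ms lam M β ≤ objective T Ms lam M' β

/-- The empirical risk
`L_T(M) = (1/n_s) ∑_{(i,j) ∈ S} x_ijᵀ M x_ij + μ (b - (1/n_d) ∑_{(i,j) ∈ D} x_ijᵀ M x_ij)`. -/
def empRisk {d n : ℕ} (T : Fin n → Example d) (μ b : ℝ) (M : Matrix (Fin d) (Fin d) ℝ) : ℝ :=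
  simAvg T M + μ * (b - disAvg T M)

/-- The dual function of the transfer problem with weights `β`, with respect to its inequality
constraint: `μ ↦ inf_{M ⪰ 0} L_T(M) + λ ‖M - ∑_j β_j M_j‖_F²`. For `λ > 0` the infimum is over a
family that is bounded below, being a linear function plus a positive definite quadratic one. -/
def dualFun {d n N : ℕ} (T : Fin n → Example d) (Ms : Fin N → Matrix (Fin d) (Fin d) ℝ)
    (lam b : ℝ) (β : EuclideanSpace ℝ (Fin N)) (μ : ℝ) : ℝ :=
  ⨅ M : {M : Matrix (Fin d) (Fin d) ℝ // M.PosSemidef},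
    (empRisk T μ b M.1 + lam * ‖M.1 - weighted Ms β‖ ^ 2)

/-- `μ` is an optimal dual variable of the inequality constraint: it maximizes the dual function
over `[0, ∞)`. -/
def IsOptimalDual {d n N : ℕ} (T : Fin n → Example d) (Ms : Fin N → Matrix (Fin d) (Fin d) ℝ)
    (lam b : ℝ) (β : EuclideanSpace ℝ (Fin N)) (μ : ℝ) : Prop :=
  0 ≤ μ ∧ ∀ ν : ℝ, 0 ≤ ν → dualFun T Ms lam b β ν ≤ dualFun T Ms lam b β μ

/-- The set of similar pairs of examples. -/
def simSet (d : ℕ) : Set (Example d × Example d) := {p | p.1.2 = p.2.2}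

/-- The set of dissimilar pairs of examples. -/
def disSet (d : ℕ) : Set (Example d × Example d) := {p | p.1.2 ≠ p.2.2}

/-- The probability that two independent examples are similar. -/
def simProb {d : ℕ} (D : Measure (Example d)) : ℝ := (D.prod D).real (simSet d)

/-- The probability that two independent examples are dissimilar. -/
def disProb {d : ℕ} (D : Measure (Example d)) : ℝ := (D.prod D).real (disSet d)

/-- The true risk, in which the averages over the similar and over the dissimilar pairs of the
sample are replaced by expectations over a random similar and a random dissimilar pair:
`L_D(M) = E[(x-x')ᵀM(x-x') | y = y'] + μ (b - E[(x-x')ᵀM(x-x') | y ≠ y'])`. -/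
def trueRisk {d : ℕ} (D : Measure (Example d)) (μ b : ℝ) (M : Matrix (Fin d) (Fin d) ℝ) : ℝ :=
  (∫ p in simSet d, sqDist M p.1.1 p.2.1 ∂(D.prod D)) / simProb D +
    μ * (b - (∫ p in disSet d, sqDist M p.1.1 p.2.1 ∂(D.prod D)) / disProb D)

/-- The Lipschitz constant `max (1 / p_s) (μ / p_d) R²` of the pairwise loss
`ζ (x-x')ᵀM(x-x') + μ b` (`ζ = 1 / p_s` on similar and `ζ = -μ / p_d` on dissimilar pairs), for
features in a set of diameter `R`. It is `2 max(1, μ) R²` if `p_s = p_d = 1/2`. -/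
def lipConst {d : ℕ} (D : Measure (Example d)) (X : Set (EuclideanSpace ℝ (Fin d)))
    (μ : ℝ) : ℝ :=
  max (1 / simProb D) (μ / disProb D) * Metric.diam X ^ 2

/-- The factor `(1 / p_s + μ / p_d) R²`. It is `2 (1 + μ) R²` if `p_s = p_d = 1/2`. -/
def admConst {d : ℕ} (D : Measure (Example d)) (X : Set (EuclideanSpace ℝ (Fin d)))
    (μ : ℝ) : ℝ :=
  (1 / simProb D + μ / disProb D) * Metric.diam X ^ 2

end

end MetricTransfer

open MetricTransfer

namespace MetricTransfer

open ProbabilityTheory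

/-! For fixed `μ`, both risks are affine in `M` with the same constant term `μ * b`. Their
difference is therefore the Frobenius inner product of `M` with a difference of averaged outer
products `(x - x')(x - x')ᵀ`, empirical against conditional expectation. Cauchy–Schwarz
(`trueRisk_sub_empRisk_le`) leaves two independent tasks: bound `‖M‖`, and show that the pair
averages concentrate. The random event enters only through the second task, so the result is uniform
in `β`, `M` and `μ` without any covering or stability argument.

Norm: strong duality, evaluated at the weighted source metric `W`, which is itself positive
semidefinite, gives `lam * ‖M - W‖ ^ 2 ≤ empRisk T μ b W` (`primal_le_lagrangian`,
`lam_mul_sq_norm_sub_le_empRisk`). This also yields the nonnegativity claim and the square root in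
the bound.

Concentration: labels are `±1`, so the indicator of a similar or dissimilar pair is `(1 ± y y') /
2`. Sums over pairs then factor into the single-sample means of `yᵏ`, `yᵏ u` and `yᵏ u uᵀ` with `k =
0, 1`, where `u` is the centred feature (`sum_pairs_eq_pairMoment`). These six means concentrate by
McDiarmid's inequality and a variance bound (`measure_norm_empMean_sub_gt_le`), and
`norm_pairAvg_sub_le` carries this over to the ratios.

The `K`-term is not needed for the estimate; it is nonnegative and only weakens it. -/

/-! ### McDiarmid's inequality -/

/-- **McDiarmid's inequality**, in the form of a bound of the moment generating function. -/
theorem hasSubgaussianMGF_of_bounded_differences {Z : Type*} [MeasurableSpace Z] (D : Measure Z)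
    [IsProbabilityMeasure D] {c : ℝ} (n : ℕ) (f : (Fin n → Z) → ℝ)
    (hf : Measurable f) {B : ℝ} (hB : ∀ T, |f T| ≤ B)
    (hd : ∀ T i z, |f (Function.update T i z) - f T| ≤ c) :
    HasSubgaussianMGF (fun T => f T - ∫ T, f T ∂(Measure.pi fun _ => D))
      (n * (‖c‖₊ / 2) ^ 2) (Measure.pi fun _ : Fin n => D) := by
  induction n with
  | zero =>
    have : ∀ T, f T - ∫ T, f T ∂(Measure.pi fun _ : Fin 0 => D) = 0 := by
      intro T
      have : f = fun _ => f T := by funext T'; rw [Subsingleton.elim T' T]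
      rw [this]; simp
    simp [this]
  | succ n ih =>
    set P := Measure.pi fun _ : Fin n => D with hP
    have hcons : Measurable fun p : Z × (Fin n → Z) => (Fin.cons p.1 p.2 : Fin (n + 1) → Z) := by
      refine measurable_pi_lambda _ fun i => ?_
      refine Fin.cases ?_ (fun j => ?_) i
      · simpa using measurable_fst
      · simpa [Function.comp_def] using (measurable_pi_apply j).comp measurable_snd
    have hmp : MeasurePreserving
        (fun p : Z × (Fin n → Z) => (Fin.cons p.1 p.2 : Fin (n + 1) → Z)) (D.prod P)
        (Measure.pi fun _ => D) := by
      have h := (measurePreserving_piFinSuccAbove (fun _ : Fin (n + 1) => D) 0).symm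
      convert h using 1
      funext p
      simp [MeasurableEquiv.piFinSuccAbove, Fin.consEquiv]
    set F : Z → (Fin n → Z) → ℝ := fun z T => f (Fin.cons z T) with hF
    have hFm : Measurable (Function.uncurry F) := hf.comp hcons
    have hFz : ∀ z, Measurable (F z) := fun z => hFm.comp measurable_prodMk_left
    have hbd : ∀ {Y : Type _} [MeasurableSpace Y] (Q : Measure Y) [IsProbabilityMeasure Q]
        (g : Y → ℝ) (hg : Measurable g) (b : ℝ) (hb : ∀ y, |g y| ≤ b), Integrable g Q := by
      intro Y _ Q _ g hg b hb
      exact Integrable.of_bound hg.aestronglyMeasurable b (.of_forall hb)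
    -- Martingale step: `fb` averages out all coordinates but the first. Its oscillation is at most
    -- `c`, so Hoeffding's lemma applies to it, while the induction hypothesis controls the
    -- fluctuation around `fb z` for each fixed `z`.
    set fb : Z → ℝ := fun z => ∫ T, F z T ∂P with hfb
    have hfbm : Measurable fb := (hFm.stronglyMeasurable.integral_prod_right).measurable
    have hfbd : ∀ z z', fb z - fb z' ≤ c := by
      intro z z'
      have h1 := hbd P (F z) (hFz z) B (fun T => hB _)
      have h2 := hbd P (F z') (hFz z') B (fun T => hB _)
      rw [hfb]
      simp only
      rw [← integral_sub h1 h2]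
      calc _ ≤ ∫ _, c ∂P := by
            refine integral_mono (h1.sub h2) (integrable_const _) fun T => ?_
            have := hd (Fin.cons z' T) 0 z
            rw [Fin.update_cons_zero] at this
            exact (abs_le.1 this).2
        _ = c := by simp
    have hm : ∫ T, f T ∂(Measure.pi fun _ => D) = ∫ z, fb z ∂D := by
      rw [← hmp.map_eq, integral_map hcons.aemeasurable hf.aestronglyMeasurable]
      exact integral_prod _ (hbd _ _ (hf.comp hcons) B (fun p => hB _))
    obtain ⟨z₀⟩ : Nonempty Z := nonempty_of_isProbabilityMeasure D
    have hbelow : BddBelow (Set.range fb) := by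
      refine ⟨fb z₀ - c, ?_⟩
      rintro _ ⟨z, rfl⟩
      linarith [hfbd z₀ z]
    have hbIcc : ∀ z, fb z ∈ Set.Icc (⨅ z, fb z) ((⨅ z, fb z) + c) := by
      intro z
      refine ⟨ciInf_le hbelow z, ?_⟩
      have : Nonempty Z := ⟨z₀⟩
      have : fb z - c ≤ ⨅ z, fb z := le_ciInf fun z' => by linarith [hfbd z z']
      linarith
    have hsub := hasSubgaussianMGF_of_mem_Icc (μ := D) hfbm.aemeasurable (.of_forall hbIcc)
    rw [add_sub_cancel_left] at hsub
    have hexpB : ∀ t : ℝ, ∀ T, |Real.exp (t * (f T - ∫ z, fb z ∂D))| ≤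
        Real.exp (|t| * (B + |∫ z, fb z ∂D|)) := by
      intro t T
      rw [abs_of_pos (Real.exp_pos _), Real.exp_le_exp]
      refine (le_abs_self _).trans ?_
      rw [abs_mul]
      gcongr
      exact (abs_sub _ _).trans (by gcongr; exact hB T)
    have hexpm : ∀ t : ℝ, Measurable fun T => Real.exp (t * (f T - ∫ z, fb z ∂D)) := fun t =>
      Real.measurable_exp.comp ((hf.sub_const _).const_mul t)
    rw [hm]
    refine ⟨fun t => hbd _ _ (hexpm t) _ (hexpB t), fun t => ?_⟩
    have hinner : ∀ z, ∫ T, Real.exp (t * (F z T - fb z)) ∂P ≤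
        Real.exp (n * (‖c‖₊ / 2) ^ 2 * t ^ 2 / 2) := by
      intro z
      have := (ih (F z) (hFz z) (fun T => hB _) (fun T i w => by
        have := hd (Fin.cons z T) i.succ w
        rw [← Fin.cons_update] at this
        exact this)).mgf_le t
      simpa [mgf] using this
    rw [mgf, ← hmp.map_eq, integral_map hcons.aemeasurable (hexpm t).aestronglyMeasurable]
    have hint : Integrable (fun p : Z × (Fin n → Z) =>
        Real.exp (t * (f (Fin.cons p.1 p.2) - ∫ z, fb z ∂D))) (D.prod P) :=
      hbd _ _ ((hexpm t).comp hcons) _ (fun p => hexpB t _)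
    rw [integral_prod _ hint]
    calc _ = ∫ z, (∫ T, Real.exp (t * (F z T - fb z)) ∂P) *
          Real.exp (t * (fb z - ∫ z, fb z ∂D)) ∂D := by
          refine integral_congr_ae (.of_forall fun z => ?_)
          simp only
          rw [← integral_mul_const]
          refine integral_congr_ae (.of_forall fun T => ?_)
          simp only [hF]
          rw [← Real.exp_add]
          congr 1
          ring
      _ ≤ ∫ z, Real.exp (n * (‖c‖₊ / 2) ^ 2 * t ^ 2 / 2) *
          Real.exp (t * (fb z - ∫ z, fb z ∂D)) ∂D := by
          refine integral_mono_of_nonneg (.of_forall fun z => ?_)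
            ((hsub.integrable_exp_mul t).const_mul _) (.of_forall fun z => ?_)
          · exact mul_nonneg (integral_nonneg fun _ => (Real.exp_pos _).le) (Real.exp_pos _).le
          · exact mul_le_mul_of_nonneg_right (hinner z) (Real.exp_pos _).le
      _ ≤ Real.exp (n * (‖c‖₊ / 2) ^ 2 * t ^ 2 / 2) *
          Real.exp ((‖c‖₊ / 2) ^ 2 * t ^ 2 / 2) := by
          rw [integral_const_mul]
          gcongr
          simpa [mgf] using hsub.mgf_le t
      _ = _ := by
          rw [← Real.exp_add]
          congr 1
          push_cast
          ring

/-- The empirical mean of `φ` over the sample `T`. -/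
noncomputable def empMean {Z E : Type*} [AddCommGroup E] [Module ℝ E] {n : ℕ} (φ : Z → E)
    (T : Fin n → Z) : E :=
  (n : ℝ)⁻¹ • ∑ i, φ (T i)

/-! ### Concentration of empirical means of bounded vectors -/

section EmpMean

variable {Z : Type*}

theorem norm_empMean_le {E : Type*} [NormedAddCommGroup E] [NormedSpace ℝ E] {n : ℕ} {φ : Z → E}
    {B : ℝ} (hB0 : 0 ≤ B) (hB : ∀ z, ‖φ z‖ ≤ B) (T : Fin n → Z) : ‖empMean φ T‖ ≤ B := by
  rw [empMean, norm_smul, norm_inv, Real.norm_natCast]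
  rcases Nat.eq_zero_or_pos n with rfl | hn
  · simpa using hB0
  have hn' : (0 : ℝ) < n := by exact_mod_cast hn
  rw [inv_mul_le_iff₀ hn']
  calc _ ≤ ∑ i : Fin n, ‖φ (T i)‖ := norm_sum_le _ _
    _ ≤ ∑ i : Fin n, B := Finset.sum_le_sum fun i _ => hB _
    _ = n * B := by simp

variable [MeasurableSpace Z] {ι : Type*} [Fintype ι]

theorem integrable_of_bounded {E : Type*} [NormedAddCommGroup E] [MeasurableSpace E] [BorelSpace E]
    [SecondCountableTopology E] (D : Measure Z) [IsFiniteMeasure D] {φ : Z → E}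
    (hφ : Measurable φ) {B : ℝ} (hB : ∀ z, ‖φ z‖ ≤ B) : Integrable φ D :=
  Integrable.of_bound hφ.aestronglyMeasurable B (.of_forall hB)

theorem norm_integral_le_of_bounded {E : Type*} [NormedAddCommGroup E] [NormedSpace ℝ E]
    (D : Measure Z) [IsProbabilityMeasure D] {φ : Z → E}
    {B : ℝ} (hB : ∀ z, ‖φ z‖ ≤ B) : ‖∫ z, φ z ∂D‖ ≤ B := by
  simpa using norm_integral_le_of_norm_le_const (μ := D) (.of_forall hB)

theorem measurable_empMean {n : ℕ} {φ : Z → EuclideanSpace ℝ ι} (hφ : Measurable φ) :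
    Measurable fun T : Fin n → Z => empMean φ T := by
  unfold empMean
  fun_prop

theorem integral_euclidean_apply (D : Measure Z) {φ : Z → EuclideanSpace ℝ ι}
    (hφ : Integrable φ D) (k : ι) : (∫ z, φ z ∂D) k = ∫ z, φ z k ∂D :=
  ((EuclideanSpace.proj (𝕜 := ℝ) k : EuclideanSpace ℝ ι →L[ℝ] ℝ).integral_comp_comm hφ).symm

variable (D : Measure Z) [IsProbabilityMeasure D] {n : ℕ} {φ : Z → EuclideanSpace ℝ ι} {B : ℝ}

theorem integral_sq_empMean_sub_le (hn : 0 < n) {X : Z → ℝ} (hX : MemLp X 2 D) :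
    ∫ T, (empMean X T - ∫ z, X z ∂D) ^ 2 ∂(Measure.pi fun _ : Fin n => D) ≤
      (∫ z, X z ^ 2 ∂D) / n := by
  have hn' : (n : ℝ) ≠ 0 := by positivity
  have hXi : ∀ i : Fin n, MemLp (fun T : Fin n → Z => X (T i)) 2 (Measure.pi fun _ => D) :=
    fun i => hX.comp_measurePreserving (measurePreserving_eval _ i)
  have hint : ∀ i : Fin n, ∫ T : Fin n → Z, X (T i) ∂(Measure.pi fun _ => D) = ∫ z, X z ∂D := by
    intro i
    have h := measurePreserving_eval (fun _ : Fin n => D) i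
    have h' := integral_map (f := X) h.measurable.aemeasurable (by
      rw [h.map_eq]; exact hX.aestronglyMeasurable)
    rw [h.map_eq] at h'
    exact h'.symm
  have hmean : ∫ T, empMean X T ∂(Measure.pi fun _ : Fin n => D) = ∫ z, X z ∂D := by
    simp only [empMean, smul_eq_mul]
    rw [integral_const_mul, integral_finsetSum _ fun i _ => (hXi i).integrable (by norm_num)]
    simp only [hint]
    simp
    field_simp
  have hL : MemLp (fun T : Fin n → Z => empMean X T) 2 (Measure.pi fun _ => D) := by
    simp only [empMean, smul_eq_mul]
    exact (memLp_finsetSum _ fun i _ => hXi i).const_mul _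
  have hvar : Var[fun T : Fin n → Z => empMean X T; Measure.pi fun _ => D] = Var[X; D] / n := by
    have h := variance_sum_pi (ι := Fin n) (μ := fun _ => D) (X := fun _ => X) fun _ => hX
    have he : (fun T : Fin n → Z => empMean X T) =
        fun T => (n : ℝ)⁻¹ * (∑ i, fun ω : Fin n → Z => X (ω i)) T := by
      funext T
      simp [empMean]
    rw [he, variance_const_mul, h]
    simp
    field_simp
  have := variance_eq_integral hL.aestronglyMeasurable.aemeasurable
  rw [hmean, hvar] at this
  rw [← this]
  gcongr
  exact variance_le_expectation_sq hX.aestronglyMeasurable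

/-- The variances of the coordinates add up to at most `B ^ 2 / n`, with no dependence on the
dimension; nonnegativity of the variance of the norm then passes from the second moment to the
first. -/
theorem integral_norm_empMean_sub_le (hn : 0 < n) (hφ : Measurable φ) (hB0 : 0 ≤ B)
    (hB : ∀ z, ‖φ z‖ ≤ B) :
    ∫ T, ‖empMean φ T - ∫ z, φ z ∂D‖ ∂(Measure.pi fun _ : Fin n => D) ≤ B / √n := by
  set P := Measure.pi fun _ : Fin n => D
  set m := ∫ z, φ z ∂D with hm
  have hn' : (0 : ℝ) < n := by exact_mod_cast hn
  have hmeas : Measurable fun T : Fin n → Z => empMean φ T - m :=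
    (measurable_empMean hφ).sub_const m
  have hbd : ∀ T : Fin n → Z, ‖empMean φ T - m‖ ≤ 2 * B := fun T =>
    (norm_sub_le _ _).trans (by
      linarith [norm_empMean_le hB0 hB T, norm_integral_le_of_bounded D hB])
  have hL : MemLp (fun T : Fin n → Z => ‖empMean φ T - m‖) 2 P :=
    MemLp.of_bound hmeas.norm.aestronglyMeasurable (2 * B) (.of_forall fun T => by simpa using hbd T)
  have hXm : ∀ k, Measurable fun z => φ z k := fun k => by fun_prop
  have hXL : ∀ k, MemLp (fun z => φ z k) 2 D := fun k =>
    MemLp.of_bound (hXm k).aestronglyMeasurable B (.of_forall fun z =>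
      (PiLp.norm_apply_le (φ z) k).trans (hB z))
  have hcoord : ∀ (T : Fin n → Z) k,
      (empMean φ T - m) k = empMean (fun z => φ z k) T - ∫ z, φ z k ∂D := by
    intro T k
    rw [PiLp.sub_apply, hm, integral_euclidean_apply D (integrable_of_bounded D hφ hB)]
    simp [empMean]
  have hsq : ∫ T, ‖empMean φ T - m‖ ^ 2 ∂P ≤ B ^ 2 / n := by
    simp only [EuclideanSpace.norm_sq_eq, Real.norm_eq_abs, sq_abs, hcoord]
    rw [integral_finsetSum]
    · calc _ ≤ ∑ k, (∫ z, φ z k ^ 2 ∂D) / n :=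
            Finset.sum_le_sum fun k _ => integral_sq_empMean_sub_le D hn (hXL k)
        _ = (∫ z, ‖φ z‖ ^ 2 ∂D) / n := by
            rw [← Finset.sum_div, ← integral_finsetSum _ fun k _ => (hXL k).integrable_sq]
            simp [EuclideanSpace.norm_sq_eq]
        _ ≤ B ^ 2 / n := by
            gcongr
            calc _ ≤ ∫ z, B ^ 2 ∂D := by
                  refine integral_mono_of_nonneg (.of_forall fun z => by positivity)
                    (integrable_const _) (.of_forall fun z => ?_)
                  exact pow_le_pow_left₀ (norm_nonneg _) (hB z) 2
              _ = B ^ 2 := by simp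
    · intro k _
      have hk : ∀ T : Fin n → Z, (empMean (fun z => φ z k) T - ∫ z, φ z k ∂D) ^ 2 =
          ((empMean φ T - m) k) ^ 2 := fun T => by rw [hcoord]
      simp only [hk]
      refine integrable_of_bounded P (B := (2 * B) ^ 2) (by fun_prop) fun T => ?_
      rw [norm_pow]
      exact pow_le_pow_left₀ (norm_nonneg _) ((PiLp.norm_apply_le _ k).trans (hbd T)) 2
  have hvar := variance_nonneg (fun T : Fin n → Z => ‖empMean φ T - m‖) P
  rw [variance_eq_sub hL] at hvar
  have h2 : (∫ T, ‖empMean φ T - m‖ ∂P) ^ 2 ≤ B ^ 2 / n := by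
    have : ∫ T, ((fun T : Fin n → Z => ‖empMean φ T - m‖) ^ 2) T ∂P ≤ B ^ 2 / n := by
      simpa using hsq
    linarith
  refine le_of_sq_le_sq ?_ (by positivity)
  rwa [div_pow, Real.sq_sqrt hn'.le]

/-- Concentration of the empirical mean of a bounded vector around its expectation. -/
theorem measure_norm_empMean_sub_gt_le (hn : 0 < n) (hφ : Measurable φ) (hB0 : 0 ≤ B)
    (hB : ∀ z, ‖φ z‖ ≤ B) {L : ℝ} (hL : 0 ≤ L) :
    (Measure.pi fun _ : Fin n => D)
      {T | B * (1 / √n + 2 * √(L / (2 * n))) < ‖empMean φ T - ∫ z, φ z ∂D‖} ≤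
      ENNReal.ofReal (Real.exp (-L)) := by
  set P := Measure.pi fun _ : Fin n => D
  set m := ∫ z, φ z ∂D with hm
  have hn' : (0 : ℝ) < n := by exact_mod_cast hn
  have hmeas : Measurable fun T : Fin n → Z => empMean φ T - m :=
    (measurable_empMean hφ).sub_const m
  have hbd : ∀ T : Fin n → Z, ‖empMean φ T - m‖ ≤ 2 * B := fun T =>
    (norm_sub_le _ _).trans (by
      linarith [norm_empMean_le hB0 hB T, norm_integral_le_of_bounded D hB])
  -- For `B = 0` the sub-Gaussian parameter vanishes and the Chernoff bound degenerates to `1`, but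
  -- the event is empty.
  rcases hB0.eq_or_lt with rfl | hBpos
  · have : {T : Fin n → Z | 0 * (1 / √n + 2 * √(L / (2 * n))) < ‖empMean φ T - m‖} = ∅ := by
      ext T
      have := hbd T
      simp only [Set.mem_ofPred_eq, Set.mem_empty_iff_false, iff_false, not_lt]
      linarith
    rw [this]
    simp
  -- Replacing one example moves the mean by at most `2 * B / n`. The variance proxy is then `B ^ 2
  -- / n`, and a deviation `2 * B * √(L / (2 * n))` has probability at most `exp (-L)`.
  have hmc := hasSubgaussianMGF_of_bounded_differences D (c := 2 * B / n) n
    (fun T => ‖empMean φ T - m‖) hmeas.norm (B := 2 * B) (fun T => by simpa using hbd T) (by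
      intro T i z
      refine (abs_norm_sub_norm_le _ _).trans ?_
      have : empMean φ (Function.update T i z) - m - (empMean φ T - m) =
          (n : ℝ)⁻¹ • (φ z - φ (T i)) := by
        rw [sub_sub_sub_cancel_right, empMean, empMean, ← smul_sub, ← Finset.sum_sub_distrib]
        congr 1
        rw [Finset.sum_eq_single i]
        · simp
        · intro j _ hj
          simp [Function.update_of_ne hj]
        · simp
      rw [this, norm_smul, norm_inv, Real.norm_natCast, inv_mul_eq_div]
      gcongr
      exact (norm_sub_le _ _).trans (by linarith [hB z, hB (T i)]))
  have hch := hmc.measure_ge_le (ε := B * (2 * √(L / (2 * n)))) (by positivity)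
  rw [← ofReal_measureReal]
  refine ENNReal.ofReal_le_ofReal ?_
  refine (measureReal_mono ?_).trans (hch.trans ?_)
  · intro T hT
    have := integral_norm_empMean_sub_le D hn hφ hB0 hB
    simp only [Set.mem_ofPred_eq] at hT ⊢
    have h2 : B * (1 / √n + 2 * √(L / (2 * n))) = B / √n + B * (2 * √(L / (2 * n))) := by ring
    linarith
  · rw [Real.exp_le_exp]
    apply le_of_eq
    push_cast
    rw [Real.norm_of_nonneg (by positivity), mul_pow, mul_pow, Real.sq_sqrt (by positivity)]
    field_simp

end EmpMean

/-! ### Strong duality for a strongly convex quadratic program -/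

section Duality

variable {E : Type*} [NormedAddCommGroup E] [InnerProductSpace ℝ E]

/-- A linear function plus a multiple of the squared distance to `v₀` has a minimizer on a complete
convex set, with quadratic growth around it. -/
theorem exists_minimizer_quadratic {K : Set E} (hne : K.Nonempty) (hK : IsComplete K)
    (hconv : Convex ℝ K) {lam : ℝ} (hlam : 0 < lam) (a v₀ : E) :
    ∃ p ∈ K, ∀ w ∈ K, inner ℝ a p + lam * ‖p - v₀‖ ^ 2 + lam * ‖w - p‖ ^ 2 ≤
      inner ℝ a w + lam * ‖w - v₀‖ ^ 2 := by
  -- Completing the square turns the minimizer into the projection of `v₀ - a / (2 * lam)`; its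
  -- variational inequality gives the quadratic growth.
  obtain ⟨p, hp, hmin⟩ :=
    exists_norm_eq_iInf_of_complete_convex hne hK hconv (v₀ - (2 * lam)⁻¹ • a)
  rw [norm_eq_iInf_iff_real_inner_le_zero hconv hp] at hmin
  refine ⟨p, hp, fun w hw => ?_⟩
  have h := hmin w hw
  have e1 : v₀ - (2 * lam)⁻¹ • a - p = -((p - v₀) + (2 * lam)⁻¹ • a) := by abel
  rw [e1, inner_neg_left, inner_add_left, inner_smul_left] at h
  have e2 : ‖w - v₀‖ ^ 2 = ‖w - p‖ ^ 2 + 2 * inner ℝ (p - v₀) (w - p) + ‖p - v₀‖ ^ 2 := by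
    rw [← sub_add_sub_cancel w p v₀, norm_add_sq_real, real_inner_comm]
  have e3 : inner ℝ a (w - p) = inner ℝ a w - inner ℝ a p := inner_sub_right _ _ _
  rw [e2]
  have h' : 0 ≤ 2 * lam * inner ℝ (p - v₀) (w - p) + inner ℝ a (w - p) := by
    have h0 : (0 : ℝ) ≤ 2 * lam * (inner ℝ (p - v₀) (w - p) +
        (2 * lam)⁻¹ * inner ℝ a (w - p)) := by
      have : 0 ≤ inner ℝ (p - v₀) (w - p) + (2 * lam)⁻¹ * inner ℝ a (w - p) := by
        simp only [conj_trivial] at h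
        linarith
      positivity
    rw [mul_add, mul_inv_cancel_left₀ (by positivity)] at h0
    exact h0
  nlinarith

/-- Strong duality for a strongly convex quadratic program over a complete convex set with one
linear inequality constraint, given that the dual optimum is attained: the optimal value is at most
the value of the Lagrangian at `v₀`. -/
theorem primal_le_lagrangian {ι : Type*} {v : ι → E} (hK : IsComplete (Set.range v))
    (hconv : Convex ℝ (Set.range v)) {lam b μ : ℝ} (hlam : 0 < lam) {a c v₀ : E} (hμ : 0 ≤ μ)
    (hdual : ∀ ν : ℝ, 0 ≤ ν →
      (⨅ i, (inner ℝ a (v i) + ν * (b - inner ℝ c (v i)) + lam * ‖v i - v₀‖ ^ 2)) ≤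
        ⨅ i, (inner ℝ a (v i) + μ * (b - inner ℝ c (v i)) + lam * ‖v i - v₀‖ ^ 2))
    {i₀ : ι} (hv₀ : v i₀ = v₀) {i : ι}
    (hmin : ∀ j, b ≤ inner ℝ c (v j) →
      inner ℝ a (v i) + lam * ‖v i - v₀‖ ^ 2 ≤ inner ℝ a (v j) + lam * ‖v j - v₀‖ ^ 2) :
    inner ℝ a (v i) + lam * ‖v i - v₀‖ ^ 2 ≤ inner ℝ a v₀ + μ * (b - inner ℝ c v₀) := by
  set F : ℝ → ι → ℝ := fun ν j =>
    inner ℝ a (v j) + ν * (b - inner ℝ c (v j)) + lam * ‖v j - v₀‖ ^ 2 with hF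
  have : Nonempty ι := ⟨i₀⟩
  have hp : ∀ ν, ∃ p, ∀ j, F ν p + lam * ‖v j - v p‖ ^ 2 ≤ F ν j := by
    intro ν
    obtain ⟨_, ⟨p, rfl⟩, h⟩ :=
      exists_minimizer_quadratic (Set.range_nonempty v) hK hconv hlam (a - ν • c) v₀
    refine ⟨p, fun j => ?_⟩
    have := h (v j) ⟨j, rfl⟩
    simp only [inner_sub_left, real_inner_smul_left] at this
    simp only [hF]
    linarith
  choose p hp using hp
  have hinf : ∀ ν, ⨅ j, F ν j = F ν (p ν) := by
    intro ν
    have hle : ∀ j, F ν (p ν) ≤ F ν j := fun j =>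
      (le_add_of_nonneg_right (by positivity)).trans (hp ν j)
    exact le_antisymm (ciInf_le ⟨_, Set.forall_mem_range.2 hle⟩ _) (le_ciInf hle)
  have hd : ∀ ν, 0 ≤ ν → F ν (p ν) ≤ F μ (p μ) := by
    intro ν hν
    rw [← hinf, ← hinf]
    exact hdual ν hν
  set s : ℝ := b - inner ℝ c (v (p μ)) with hs
  -- The slack `s` acts as the derivative of the dual function at `μ`. Adding the growth
  -- inequalities of the minimizers for `μ` and `μ + t` shows that they differ by `O(t)`; optimality
  -- of `μ` then leaves `t * s = O(t ^ 2)` from above, for each admissible sign of `t`.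
  have key : ∀ t, 0 ≤ μ + t → t * s ≤ ‖c‖ ^ 2 / (2 * lam) * t ^ 2 := by
    intro t ht
    set Δ := v (p (μ + t)) - v (p μ) with hΔ
    have h1 := hp μ (p (μ + t))
    have h2 := hp (μ + t) (p μ)
    have h3 := hd (μ + t) ht
    rw [norm_sub_rev] at h2
    rw [← hΔ] at h1 h2
    have he : inner ℝ c Δ = inner ℝ c (v (p (μ + t))) - inner ℝ c (v (p μ)) :=
      inner_sub_right _ _ _
    simp only [hF] at h1 h2 h3
    set e := inner ℝ c Δ with hedef
    have hcs : e ^ 2 ≤ ‖c‖ ^ 2 * ‖Δ‖ ^ 2 := by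
      rw [← mul_pow, ← sq_abs]
      exact pow_le_pow_left₀ (abs_nonneg _) (abs_real_inner_le_norm c Δ) 2
    have hte : 2 * lam * ‖Δ‖ ^ 2 ≤ t * e := by rw [he]; nlinarith
    have hts : t * s ≤ t * e := by
      have : 0 ≤ lam * ‖Δ‖ ^ 2 := by positivity
      rw [he, hs]; nlinarith
    refine hts.trans ?_
    have hlam2 : 0 < 2 * lam := by positivity
    have hee : e ^ 2 ≤ ‖c‖ ^ 2 / (2 * lam) * (t * e) := by
      calc e ^ 2 ≤ ‖c‖ ^ 2 * ‖Δ‖ ^ 2 := hcs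
        _ = ‖c‖ ^ 2 / (2 * lam) * (2 * lam * ‖Δ‖ ^ 2) := by field_simp
        _ ≤ _ := by gcongr
    have hte0 : 0 ≤ t * e := le_trans (by positivity) hte
    rcases hte0.eq_or_lt with h | h
    · rw [← h]; positivity
    · refine le_of_mul_le_mul_right ?_ h
      calc t * e * (t * e) = t ^ 2 * e ^ 2 := by ring
        _ ≤ t ^ 2 * (‖c‖ ^ 2 / (2 * lam) * (t * e)) := by gcongr
        _ = _ := by ring
  have hC : 0 ≤ ‖c‖ ^ 2 / (2 * lam) := by positivity
  set C := ‖c‖ ^ 2 / (2 * lam)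
  -- Small positive `t` gives feasibility of the Lagrangian minimizer; the `+ 1` covers `C = 0`.
  have hs0 : s ≤ 0 := by
    by_contra! hpos
    have h := key (s / (2 * (C + 1))) (by positivity)
    have h2 : C * (s / (2 * (C + 1))) ^ 2 < s / (2 * (C + 1)) * s := by
      have : C * (s / (2 * (C + 1))) < s := by
        rw [← mul_div_assoc, div_lt_iff₀ (by positivity)]
        nlinarith
      calc _ = s / (2 * (C + 1)) * (C * (s / (2 * (C + 1)))) := by ring
        _ < _ := by gcongr
    linarith
  -- Complementary slackness: if `μ > 0`, small negative `t` is also admissible and forces `s = 0`.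
  have hslack : μ * s = 0 := by
    rcases hμ.eq_or_lt with h | h
    · rw [← h, zero_mul]
    · have : s = 0 := by
        by_contra hne
        have hneg : 0 < -s := neg_pos.2 (lt_of_le_of_ne hs0 hne)
        set r := min μ (-s / (2 * (C + 1))) with hr
        have hr0 : 0 < r := lt_min h (by positivity)
        have hrμ : r ≤ μ := min_le_left _ _
        have hk := key (-r) (by linarith)
        have : C * r < -s := by
          calc C * r ≤ C * (-s / (2 * (C + 1))) := by gcongr; exact min_le_right _ _
            _ < -s := by
              rw [← mul_div_assoc, div_lt_iff₀ (by positivity)]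
              nlinarith
        nlinarith
      rw [this, mul_zero]
  -- The Lagrangian minimizer is a feasible competitor, and `v₀` is a competitor for the Lagrangian
  -- at which the quadratic term vanishes.
  calc _ ≤ inner ℝ a (v (p μ)) + lam * ‖v (p μ) - v₀‖ ^ 2 := hmin _ (by linarith)
    _ = F μ (p μ) := by simp only [hF]; rw [← hs, hslack]; ring
    _ ≤ F μ i₀ := (le_add_of_nonneg_right (by positivity)).trans (hp μ i₀)
    _ = _ := by simp [hF, hv₀]

end Duality

noncomputable section

/-- A matrix as a vector of a Euclidean space, so that the Frobenius norm becomes the norm. -/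
def matVec {d : ℕ} (M : Matrix (Fin d) (Fin d) ℝ) : EuclideanSpace ℝ (Fin d × Fin d) :=
  WithLp.toLp 2 fun p => M p.1 p.2

/-- The outer product `u vᵀ` as a vector of a Euclidean space. -/
def outer {d : ℕ} (u v : EuclideanSpace ℝ (Fin d)) : EuclideanSpace ℝ (Fin d × Fin d) :=
  WithLp.toLp 2 fun p => u p.1 * v p.2

/-! ### Matrices as Euclidean vectors, and the distance of a learned metric from its source -/

section Matrices

variable {d : ℕ}

@[simp]
theorem outer_apply (u v : EuclideanSpace ℝ (Fin d)) (p : Fin d × Fin d) :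
    outer u v p = u p.1 * v p.2 := rfl

@[simp]
theorem matVec_apply (M : Matrix (Fin d) (Fin d) ℝ) (p : Fin d × Fin d) :
    matVec M p = M p.1 p.2 := rfl

theorem norm_outer (u v : EuclideanSpace ℝ (Fin d)) : ‖outer u v‖ = ‖u‖ * ‖v‖ := by
  rw [← sq_eq_sq₀ (norm_nonneg _) (by positivity), mul_pow]
  simp only [EuclideanSpace.norm_sq_eq, outer_apply, Fintype.sum_prod_type, norm_mul, mul_pow,
    Finset.sum_mul_sum]

theorem norm_matVec (M : Matrix (Fin d) (Fin d) ℝ) : ‖matVec M‖ = ‖M‖ := by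
  rw [EuclideanSpace.norm_eq, Matrix.frobenius_norm_def, Real.sqrt_eq_rpow,
    Fintype.sum_prod_type]
  simp

theorem matVec_sub (M M' : Matrix (Fin d) (Fin d) ℝ) :
    matVec (M - M') = matVec M - matVec M' := rfl

theorem sqDist_eq_inner (M : Matrix (Fin d) (Fin d) ℝ) (x x' : EuclideanSpace ℝ (Fin d)) :
    sqDist M x x' = inner ℝ (outer (x - x') (x - x')) (matVec M) := by
  simp only [sqDist, dotProduct, Matrix.mulVec, PiLp.inner_apply, Fintype.sum_prod_type,
    outer_apply, matVec_apply, Finset.mul_sum, RCLike.inner_apply, conj_trivial]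
  refine Finset.sum_congr rfl fun i _ => Finset.sum_congr rfl fun j _ => ?_
  ring

/-- Writing the semidefinite cone as an intersection of closed linear conditions makes it complete,
as the projection argument requires. -/
theorem range_matVec_posSemidef :
    Set.range (fun M : {M : Matrix (Fin d) (Fin d) ℝ // M.PosSemidef} => matVec M.1) =
      (⋂ (i) (j), {v : EuclideanSpace ℝ (Fin d × Fin d) | v (j, i) = v (i, j)}) ∩
        ⋂ x : EuclideanSpace ℝ (Fin d),
          {v | 0 ≤ inner ℝ (outer x x) v} := by
  have hq : ∀ (M : Matrix (Fin d) (Fin d) ℝ) (x : EuclideanSpace ℝ (Fin d)),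
      star x.ofLp ⬝ᵥ (M *ᵥ x.ofLp) = inner ℝ (outer x x) (matVec M) := by
    intro M x
    have := sqDist_eq_inner M x 0
    simpa [sqDist] using this
  ext v
  simp only [Set.mem_range, Set.mem_inter_iff, Set.mem_iInter, Set.mem_ofPred_eq]
  constructor
  · rintro ⟨⟨M, hM⟩, rfl⟩
    refine ⟨fun i j => ?_, fun x => ?_⟩
    · simpa using hM.isHermitian.apply i j
    · rw [← hq]
      exact hM.dotProduct_mulVec_nonneg _
  · rintro ⟨h1, h2⟩
    refine ⟨⟨Matrix.of fun i j => v (i, j), ?_⟩, ?_⟩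
    · refine Matrix.PosSemidef.of_dotProduct_mulVec_nonneg ?_ fun x => ?_
      · ext i j
        simpa using h1 i j
      · have := h2 (WithLp.toLp 2 x)
        rw [show v = matVec (Matrix.of fun i j => v (i, j)) from rfl, ← hq] at this
        exact this
    · rfl

theorem isComplete_range_matVec_posSemidef :
    IsComplete (Set.range fun M : {M : Matrix (Fin d) (Fin d) ℝ // M.PosSemidef} =>
      matVec M.1) := by
  rw [range_matVec_posSemidef]
  refine IsClosed.isComplete (IsClosed.inter ?_ ?_)
  · exact isClosed_iInter fun i => isClosed_iInter fun j =>
      isClosed_eq (by fun_prop) (by fun_prop)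
  · exact isClosed_iInter fun x => isClosed_le (by fun_prop) (by fun_prop)

theorem convex_range_matVec_posSemidef :
    Convex ℝ (Set.range fun M : {M : Matrix (Fin d) (Fin d) ℝ // M.PosSemidef} =>
      matVec M.1) := by
  rintro _ ⟨M, rfl⟩ _ ⟨M', rfl⟩ s t hs ht _
  exact ⟨⟨s • M.1 + t • M'.1, (M.2.smul hs).add (M'.2.smul ht)⟩, rfl⟩

theorem posSemidef_weighted {N : ℕ} {Ms : Fin N → Matrix (Fin d) (Fin d) ℝ}
    (hMs : ∀ j, (Ms j).PosSemidef) {β : EuclideanSpace ℝ (Fin N)} (hβ : β ∈ weightSet N) :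
    (weighted Ms β).PosSemidef :=
  Matrix.posSemidef_sum _ fun j _ => (hMs j).smul (hβ.1 j)

theorem sqDist_nonneg {M : Matrix (Fin d) (Fin d) ℝ} (hM : M.PosSemidef)
    (x x' : EuclideanSpace ℝ (Fin d)) : 0 ≤ sqDist M x x' :=
  hM.dotProduct_mulVec_nonneg _

/-- The average of the outer squares of the differences of the features over a set of pairs. -/
def pairAvg {n : ℕ} (T : Fin n → Example d) (s : Finset (Fin n × Fin n)) :
    EuclideanSpace ℝ (Fin d × Fin d) :=
  (s.card : ℝ)⁻¹ • ∑ p ∈ s, outer ((T p.1).1 - (T p.2).1) ((T p.1).1 - (T p.2).1)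

theorem simAvg_eq_inner {n : ℕ} (T : Fin n → Example d) (M : Matrix (Fin d) (Fin d) ℝ) :
    simAvg T M = inner ℝ (pairAvg T (simPairs T)) (matVec M) := by
  simp only [simAvg, pairAvg, sqDist_eq_inner, real_inner_smul_left, sum_inner]
  rw [div_eq_inv_mul]

theorem disAvg_eq_inner {n : ℕ} (T : Fin n → Example d) (M : Matrix (Fin d) (Fin d) ℝ) :
    disAvg T M = inner ℝ (pairAvg T (disPairs T)) (matVec M) := by
  simp only [disAvg, pairAvg, sqDist_eq_inner, real_inner_smul_left, sum_inner]
  rw [div_eq_inv_mul]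

/-- A learned metric is close to the weighted source metric, in terms of the empirical risk of the
latter. -/
theorem lam_mul_sq_norm_sub_le_empRisk {n N : ℕ} {T : Fin n → Example d}
    {Ms : Fin N → Matrix (Fin d) (Fin d) ℝ} (hMs : ∀ j, (Ms j).PosSemidef) {lam b μ : ℝ}
    (hlam : 0 < lam) {β : EuclideanSpace ℝ (Fin N)} {M : Matrix (Fin d) (Fin d) ℝ}
    (hM : IsLearned T Ms lam b β M) (hμ : IsOptimalDual T Ms lam b β μ) :
    lam * ‖M - weighted Ms β‖ ^ 2 ≤ empRisk T μ b (weighted Ms β) := by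
  obtain ⟨hβ, ⟨-, hpsd⟩, hmin⟩ := hM
  have h := primal_le_lagrangian isComplete_range_matVec_posSemidef convex_range_matVec_posSemidef
    hlam (a := pairAvg T (simPairs T)) (c := pairAvg T (disPairs T)) (b := b)
    (v₀ := matVec (weighted Ms β)) hμ.1 ?_ (i₀ := ⟨_, posSemidef_weighted hMs hβ⟩) rfl
    (i := ⟨M, hpsd⟩) ?_
  · simp only [← simAvg_eq_inner, ← disAvg_eq_inner, ← matVec_sub, norm_matVec] at h
    -- The primal value is `simAvg T M` plus the penalty, so discarding the first term leaves the
    -- bound on the penalty.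
    have h0 : 0 ≤ simAvg T M :=
      div_nonneg (Finset.sum_nonneg fun p _ => sqDist_nonneg hpsd _ _) (Nat.cast_nonneg _)
    rw [empRisk]
    linarith
  · intro ν hν
    simp only [← simAvg_eq_inner, ← disAvg_eq_inner, ← matVec_sub, norm_matVec]
    exact hμ.2 ν hν
  · rintro ⟨M', hM'⟩ hb
    simp only [← simAvg_eq_inner, ← disAvg_eq_inner, ← matVec_sub, norm_matVec] at hb ⊢
    exact hmin M' ⟨by linarith, hM'⟩

end Matrices

/-! ### Pair statistics as polynomials in single-sample means -/

section PairStatistics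

variable {d n : ℕ}

theorem integral_add_sub_sub {Y : Type*} [MeasurableSpace Y] {P : Measure Y}
    {f₁ f₂ f₃ f₄ : Y → ℝ} (h₁ : Integrable f₁ P) (h₂ : Integrable f₂ P) (h₃ : Integrable f₃ P)
    (h₄ : Integrable f₄ P) :
    ∫ y, (f₁ y + f₂ y - f₃ y - f₄ y) ∂P =
      ∫ y, f₁ y ∂P + ∫ y, f₂ y ∂P - ∫ y, f₃ y ∂P - ∫ y, f₄ y ∂P := by
  have h₁₂ : Integrable (fun y => f₁ y + f₂ y) P := h₁.add h₂
  have h₁₂₃ : Integrable (fun y => f₁ y + f₂ y - f₃ y) P := h₁₂.sub h₃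
  rw [integral_sub h₁₂₃ h₄, integral_sub h₁₂ h₃, integral_add h₁ h₂]

theorem outer_sub_left (u u' v : EuclideanSpace ℝ (Fin d)) :
    outer (u - u') v = outer u v - outer u' v := by
  ext p
  simp [sub_mul]

theorem outer_sub_right (u v v' : EuclideanSpace ℝ (Fin d)) :
    outer u (v - v') = outer u v - outer u v' := by
  ext p
  simp [mul_sub]

theorem measurable_outer {Y : Type*} [MeasurableSpace Y] {f g : Y → EuclideanSpace ℝ (Fin d)}
    (hf : Measurable f) (hg : Measurable g) : Measurable fun y => outer (f y) (g y) := by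
  unfold outer
  fun_prop

/-- The mean of `w w' (u - u')(u - u')ᵀ` over two independent copies of `(w, u)`, in terms of the
means `q`, `m` and `S` of `w`, `w u` and `w u uᵀ`. -/
def pairMoment (q : ℝ) (m : EuclideanSpace ℝ (Fin d)) (S : EuclideanSpace ℝ (Fin d × Fin d)) :
    EuclideanSpace ℝ (Fin d × Fin d) :=
  (2 : ℝ) • (q • S - outer m m)

/-- Telescoping the two products gives four terms of size at most `R ^ 2 * r`; the factor `2` of
`pairMoment` makes this `8`. -/
theorem norm_pairMoment_sub_le {R r q q' : ℝ} {m m' : EuclideanSpace ℝ (Fin d)}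
    {S S' : EuclideanSpace ℝ (Fin d × Fin d)} (hR : 0 ≤ R) (hr : 0 ≤ r)
    (hq : |q| ≤ 1) (hm : ‖m‖ ≤ R) (hm' : ‖m'‖ ≤ R) (hS' : ‖S'‖ ≤ R ^ 2)
    (dq : |q - q'| ≤ r) (dm : ‖m - m'‖ ≤ R * r) (dS : ‖S - S'‖ ≤ R ^ 2 * r) :
    ‖pairMoment q m S - pairMoment q' m' S'‖ ≤ 8 * (R ^ 2 * r) := by
  have e : pairMoment q m S - pairMoment q' m' S' =
      (2 : ℝ) • (q • (S - S') + (q - q') • S' - (outer m (m - m') + outer (m - m') m')) := by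
    rw [pairMoment, pairMoment, outer_sub_left, outer_sub_right]
    module
  rw [e, norm_smul, Real.norm_ofNat]
  have h1 : ‖q • (S - S')‖ ≤ 1 * (R ^ 2 * r) := by
    rw [norm_smul, Real.norm_eq_abs]; gcongr
  have h2 : ‖(q - q') • S'‖ ≤ r * R ^ 2 := by
    rw [norm_smul, Real.norm_eq_abs]; gcongr
  have h3 : ‖outer m (m - m')‖ ≤ R * (R * r) := by rw [norm_outer]; gcongr
  have h4 : ‖outer (m - m') m'‖ ≤ (R * r) * R := by rw [norm_outer]; gcongr
  have h5 := norm_sub_le (q • (S - S') + (q - q') • S') (outer m (m - m') + outer (m - m') m')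
  have h6 := norm_add_le (q • (S - S')) ((q - q') • S')
  have h7 := norm_add_le (outer m (m - m')) (outer (m - m') m')
  nlinarith

section Generic

variable {Z : Type*} {w : Z → ℝ} {u : Z → EuclideanSpace ℝ (Fin d)}

/-- Expanding the outer square separates the two indices. The identity is exact because all ordered
pairs occur, including the diagonal ones, whose outer products vanish.
`integral_pairs_eq_pairMoment` is its population counterpart, by Fubini. -/
theorem sum_pairs_eq_pairMoment (T : Fin n → Z) :
    ((n : ℝ) ^ 2)⁻¹ • ∑ p : Fin n × Fin n, (w (T p.1) * w (T p.2)) •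
        outer (u (T p.1) - u (T p.2)) (u (T p.1) - u (T p.2)) =
      pairMoment (empMean w T) (empMean (fun z => w z • u z) T)
        (empMean (fun z => w z • outer (u z) (u z)) T) := by
  ext ⟨k, l⟩
  have e : ∀ p : Fin n × Fin n, w (T p.1) * w (T p.2) *
      ((u (T p.1) k - u (T p.2) k) * (u (T p.1) l - u (T p.2) l)) =
      (w (T p.1) * (u (T p.1) k * u (T p.1) l)) * w (T p.2) +
      w (T p.1) * (w (T p.2) * (u (T p.2) k * u (T p.2) l)) -
      (w (T p.1) * u (T p.1) k) * (w (T p.2) * u (T p.2) l) -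
      (w (T p.1) * u (T p.1) l) * (w (T p.2) * u (T p.2) k) := fun p => by ring
  simp only [pairMoment, empMean, PiLp.smul_apply, PiLp.sub_apply, outer_apply, smul_eq_mul,
    WithLp.ofLp_sum, Finset.sum_apply, e, Finset.sum_sub_distrib, Finset.sum_add_distrib]
  simp only [Fintype.sum_prod_type, ← Finset.sum_mul_sum]
  ring

theorem sum_pairs_mul_eq_sq (T : Fin n → Z) :
    ((n : ℝ) ^ 2)⁻¹ * ∑ p : Fin n × Fin n, w (T p.1) * w (T p.2) = (empMean w T) ^ 2 := by
  simp only [empMean, smul_eq_mul, Fintype.sum_prod_type, ← Finset.sum_mul_sum]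
  ring

variable [MeasurableSpace Z] (D : Measure Z) [IsProbabilityMeasure D] {R : ℝ}

theorem integrable_pairs (hw : Measurable w) (hu : Measurable u)
    (hw1 : ∀ z, |w z| ≤ 1) (huR : ∀ z, ‖u z‖ ≤ R) :
    Integrable (fun p : Z × Z => (w p.1 * w p.2) • outer (u p.1 - u p.2) (u p.1 - u p.2))
      (D.prod D) := by
  refine integrable_of_bounded _ (B := 1 * 1 * ((R + R) * (R + R))) ?_ fun p => ?_
  · have := measurable_outer (d := d) (Y := Z × Z) (f := fun p => u p.1 - u p.2)
      (g := fun p => u p.1 - u p.2) (by fun_prop) (by fun_prop)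
    fun_prop
  · have hd : ‖u p.1 - u p.2‖ ≤ R + R :=
      (norm_sub_le _ _).trans (add_le_add (huR _) (huR _))
    have h0 : 0 ≤ R + R := (norm_nonneg _).trans hd
    rw [norm_smul, norm_mul, norm_outer]
    have h1 := hw1 p.1
    have h2 := hw1 p.2
    simp only [Real.norm_eq_abs]
    gcongr

theorem integral_pairs_eq_pairMoment (hw : Measurable w) (hu : Measurable u)
    (hw1 : ∀ z, |w z| ≤ 1) (huR : ∀ z, ‖u z‖ ≤ R) :
    ∫ p, (w p.1 * w p.2) • outer (u p.1 - u p.2) (u p.1 - u p.2) ∂(D.prod D) =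
      pairMoment (∫ z, w z ∂D) (∫ z, w z • u z ∂D) (∫ z, w z • outer (u z) (u z) ∂D) := by
  have hou : Measurable fun z => outer (u z) (u z) := measurable_outer hu hu
  have hwi : Integrable w D := integrable_of_bounded D hw (B := 1) hw1
  have hmi : Integrable (fun z => w z • u z) D :=
    integrable_of_bounded D (B := 1 * R) (by fun_prop) fun z => by
      rw [norm_smul]
      exact mul_le_mul (hw1 z) (huR z) (norm_nonneg _) zero_le_one
  have hSi : Integrable (fun z => w z • outer (u z) (u z)) D :=
    integrable_of_bounded D (B := 1 * (R * R)) (by fun_prop) fun z => by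
      rw [norm_smul, norm_outer]
      exact mul_le_mul (hw1 z) (mul_self_le_mul_self (norm_nonneg _) (huR z)) (by positivity)
        zero_le_one
  have hmk : ∀ k, Integrable (fun z => w z * u z k) D := fun k => by
    simpa using (EuclideanSpace.proj (𝕜 := ℝ) k : EuclideanSpace ℝ (Fin d) →L[ℝ] ℝ).integrable_comp hmi
  have hSk : ∀ k l, Integrable (fun z => w z * (u z k * u z l)) D := fun k l => by
    simpa using (EuclideanSpace.proj (𝕜 := ℝ) (k, l) :
      EuclideanSpace ℝ (Fin d × Fin d) →L[ℝ] ℝ).integrable_comp hSi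
  ext ⟨k, l⟩
  rw [integral_euclidean_apply _ (integrable_pairs D hw hu hw1 huR)]
  have e : ∀ p : Z × Z, w p.1 * w p.2 * ((u p.1 k - u p.2 k) * (u p.1 l - u p.2 l)) =
      (w p.1 * (u p.1 k * u p.1 l)) * w p.2 + w p.1 * (w p.2 * (u p.2 k * u p.2 l)) -
      (w p.1 * u p.1 k) * (w p.2 * u p.2 l) - (w p.1 * u p.1 l) * (w p.2 * u p.2 k) :=
    fun p => by ring
  simp only [pairMoment, PiLp.smul_apply, PiLp.sub_apply, outer_apply, smul_eq_mul, e]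
  rw [integral_euclidean_apply D hmi, integral_euclidean_apply D hmi,
    integral_euclidean_apply D hSi]
  have i1 := (hSk k l).mul_prod hwi
  have i2 := hwi.mul_prod (hSk k l)
  have i3 := (hmk k).mul_prod (hmk l)
  have i4 := (hmk l).mul_prod (hmk k)
  rw [integral_add_sub_sub i1 i2 i3 i4,
    integral_prod_mul (fun z => w z * (u z k * u z l)) w,
    integral_prod_mul w (fun z => w z * (u z k * u z l)),
    integral_prod_mul (fun z => w z * u z k) (fun z => w z * u z l),
    integral_prod_mul (fun z => w z * u z l) (fun z => w z * u z k)]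
  simp only [PiLp.smul_apply, outer_apply, smul_eq_mul]
  ring

end Generic

end PairStatistics

/-! ### Concentration of the averages over similar and dissimilar pairs -/

section Labels

variable {d n : ℕ}

/-- The label of an example as a real number. -/
def labelVal (z : Example d) : ℝ := ((z.2 : ℤ) : ℝ)

theorem labelVal_eq_or (z : Example d) : labelVal z = -1 ∨ labelVal z = 1 := by
  rcases z.2.2 with h | h
  · left; rw [labelVal, h]; simp
  · right; rw [labelVal, Set.mem_singleton_iff.1 h]; simp

theorem labelVal_eq_iff (z z' : Example d) : labelVal z = labelVal z' ↔ z.2 = z'.2 := by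
  rw [labelVal, labelVal, Int.cast_inj, Subtype.ext_iff]

theorem measurable_labelVal : Measurable (labelVal (d := d)) :=
  (measurable_from_top (f := fun m : ℤ => (m : ℝ))).comp
    (measurable_subtype_coe.comp measurable_snd)

theorem abs_labelVal_pow_le (k : ℕ) (z : Example d) : |labelVal z ^ k| ≤ 1 := by
  rw [abs_pow]
  rcases labelVal_eq_or z with h | h <;> simp [h]

/-- Being polynomial in the labels, the indicator lets a sum over similar pairs split into products
of single-sample sums. -/
theorem ite_label_eq (z z' : Example d) :
    (if z.2 = z'.2 then (1 : ℝ) else 0) = (1 + 1 * (labelVal z * labelVal z')) / 2 := by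
  have := labelVal_eq_iff z z'
  rcases labelVal_eq_or z with h | h <;> rcases labelVal_eq_or z' with h' | h' <;>
    rw [h, h'] at this ⊢ <;> norm_num at this ⊢ <;> exact this

theorem ite_label_ne (z z' : Example d) :
    (if z.2 ≠ z'.2 then (1 : ℝ) else 0) = (1 + -1 * (labelVal z * labelVal z')) / 2 := by
  have := ite_label_eq z z'
  by_cases h : z.2 = z'.2
  · rw [if_pos h] at this
    rw [if_neg (not_not.2 h)]
    linarith
  · rw [if_neg h] at this
    rw [if_pos h]
    linarith

theorem measurableSet_simSet : MeasurableSet (simSet d) := by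
  have h : simSet d = {p | labelVal p.1 = labelVal p.2} := by
    ext p
    exact (labelVal_eq_iff _ _).symm
  rw [h]
  exact measurableSet_eq_fun (measurable_labelVal.comp measurable_fst)
    (measurable_labelVal.comp measurable_snd)

theorem measurableSet_disSet : MeasurableSet (disSet d) :=
  (measurableSet_simSet (d := d)).compl

/-- The empirical means of `yᵏ`, `yᵏ u` and `yᵏ u uᵀ`, for `k = 0, 1`, are close to their
expectations, relative to the bound `R` of the norm of `u`. -/
def MomentsClose (D : Measure (Example d)) (u : Example d → EuclideanSpace ℝ (Fin d)) (R r : ℝ)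
    (T : Fin n → Example d) : Prop :=
  ∀ k : Fin 2,
    |empMean (fun z => labelVal z ^ (k : ℕ)) T - ∫ z, labelVal z ^ (k : ℕ) ∂D| ≤ r ∧
    ‖empMean (fun z => labelVal z ^ (k : ℕ) • u z) T - ∫ z, labelVal z ^ (k : ℕ) • u z ∂D‖ ≤
      R * r ∧
    ‖empMean (fun z => labelVal z ^ (k : ℕ) • outer (u z) (u z)) T -
      ∫ z, labelVal z ^ (k : ℕ) • outer (u z) (u z) ∂D‖ ≤ R ^ 2 * r

variable (D : Measure (Example d)) {x₀ : EuclideanSpace ℝ (Fin d)}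
  {u : Example d → EuclideanSpace ℝ (Fin d)} {R : ℝ}

theorem outer_sub_ae_eq [SFinite D] (hux : ∀ᵐ z ∂D, u z = z.1 - x₀) :
    (fun p : Example d × Example d => outer (u p.1 - u p.2) (u p.1 - u p.2)) =ᵐ[D.prod D]
      fun p => outer (p.1.1 - p.2.1) (p.1.1 - p.2.1) := by
  have h1 := Measure.quasiMeasurePreserving_fst (μ := D) (ν := D) |>.ae hux
  have h2 := Measure.quasiMeasurePreserving_snd (μ := D) (ν := D) |>.ae hux
  filter_upwards [h1, h2] with p hp1 hp2
  rw [hp1, hp2, sub_sub_sub_cancel_right]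

variable [IsProbabilityMeasure D]

theorem measure_abs_empMean_sub_gt_le {Z : Type*} [MeasurableSpace Z] (D : Measure Z)
    [IsProbabilityMeasure D] (hn : 0 < n) {w : Z → ℝ} (hw : Measurable w)
    (hw1 : ∀ z, |w z| ≤ 1) {L : ℝ} (hL : 0 ≤ L) :
    (Measure.pi fun _ : Fin n => D)
      {T | 1 / √n + 2 * √(L / (2 * n)) < |empMean w T - ∫ z, w z ∂D|} ≤
      ENNReal.ofReal (Real.exp (-L)) := by
  set φ : Z → EuclideanSpace ℝ Unit := fun z => WithLp.toLp 2 fun _ => w z with hφ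
  have hnorm : ∀ v : EuclideanSpace ℝ Unit, ‖v‖ = |v ()| := fun v => by
    simp [EuclideanSpace.norm_eq, Real.sqrt_sq_eq_abs]
  have hφm : Measurable φ := by fun_prop
  have hφ1 : ∀ z, ‖φ z‖ ≤ 1 := fun z => by rw [hnorm]; exact hw1 z
  have h := measure_norm_empMean_sub_gt_le D hn hφm zero_le_one hφ1 hL
  have e : ∀ T : Fin n → Z, ‖empMean φ T - ∫ z, φ z ∂D‖ = |empMean w T - ∫ z, w z ∂D| := by
    intro T
    rw [hnorm, PiLp.sub_apply, integral_euclidean_apply D (integrable_of_bounded D hφm hφ1)]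
    simp [empMean, hφ]
  simpa only [e, one_mul] using h

/-- Union bound over six events: three statistics for each `k ∈ {0, 1}`. -/
theorem measure_not_momentsClose_le (hn : 0 < n) (hu : Measurable u) (hR : 0 ≤ R)
    (huR : ∀ z, ‖u z‖ ≤ R) {L : ℝ} (hL : 0 ≤ L) :
    (Measure.pi fun _ : Fin n => D)
      {T | ¬ MomentsClose D u R (1 / √n + 2 * √(L / (2 * n))) T} ≤
      ENNReal.ofReal (6 * Real.exp (-L)) := by
  set r := 1 / √n + 2 * √(L / (2 * n)) with hr
  set P := Measure.pi fun _ : Fin n => D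
  set δ := ENNReal.ofReal (Real.exp (-L)) with hδ
  have hwm : ∀ k : ℕ, Measurable fun z : Example d => labelVal z ^ k := fun k =>
    measurable_labelVal.pow_const k
  have hou : Measurable fun z => outer (u z) (u z) := measurable_outer hu hu
  have hk : ∀ k : Fin 2, P {T | ¬ (
      |empMean (fun z => labelVal z ^ (k : ℕ)) T - ∫ z, labelVal z ^ (k : ℕ) ∂D| ≤ r ∧
      ‖empMean (fun z => labelVal z ^ (k : ℕ) • u z) T - ∫ z, labelVal z ^ (k : ℕ) • u z ∂D‖ ≤
        R * r ∧
      ‖empMean (fun z => labelVal z ^ (k : ℕ) • outer (u z) (u z)) T -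
        ∫ z, labelVal z ^ (k : ℕ) • outer (u z) (u z) ∂D‖ ≤ R ^ 2 * r)} ≤ δ + (δ + δ) := by
    intro k
    have h1 := measure_abs_empMean_sub_gt_le D hn (hwm k) (abs_labelVal_pow_le k) hL
    have h2 := measure_norm_empMean_sub_gt_le D hn
      (φ := fun z => labelVal z ^ (k : ℕ) • u z) ((hwm k).smul hu) hR (fun z => by
        rw [norm_smul, ← one_mul R]
        exact mul_le_mul (abs_labelVal_pow_le k z) (huR z) (norm_nonneg _) zero_le_one) hL
    have h3 := measure_norm_empMean_sub_gt_le D hn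
      (φ := fun z => labelVal z ^ (k : ℕ) • outer (u z) (u z)) ((hwm k).smul hou)
      (sq_nonneg R) (fun z => by
        rw [norm_smul, norm_outer, ← one_mul (R ^ 2), sq]
        exact mul_le_mul (abs_labelVal_pow_le k z)
          (mul_self_le_mul_self (norm_nonneg _) (huR z)) (by positivity) zero_le_one) hL
    refine (measure_mono ?_).trans ((measure_union_le _ _).trans
      (add_le_add h1 ((measure_union_le _ _).trans (add_le_add h2 h3))))
    intro T hT
    simp only [Set.mem_ofPred_eq, Set.mem_union] at hT ⊢
    by_contra! h
    exact hT h
  calc P {T | ¬ MomentsClose D u R r T} ≤ ∑ k : Fin 2, (δ + (δ + δ)) := by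
        refine (measure_mono ?_).trans ((measure_iUnion_fintype_le P _).trans
          (Finset.sum_le_sum fun k _ => hk k))
        intro T hT
        simpa only [MomentsClose, not_forall, Set.mem_iUnion, Set.mem_ofPred_eq] using hT
    _ = ENNReal.ofReal (6 * Real.exp (-L)) := by
        rw [ENNReal.ofReal_mul (by norm_num), ← hδ]
        simp
        ring

/-- A ratio of nearby quantities. -/
theorem norm_sub_inv_smul_le {E : Type*} [NormedAddCommGroup E] [NormedSpace ℝ E] {A U V : E}
    {p q B : ℝ} (hp : 0 < p) (hA : ‖A‖ ≤ B) (hU : q • A = U) :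
    ‖A - p⁻¹ • V‖ ≤ (‖U - V‖ + |p - q| * B) / p := by
  -- Only the true probability `p` is inverted. The a priori bound on `A` absorbs the error in the
  -- denominator, so the empirical frequency `q` needs no lower bound and may be zero.
  have e : A - p⁻¹ • V = p⁻¹ • ((U - V) + (p - q) • A) := by
    have h : q • A - V + (p - q) • A = p • A - V := by module
    rw [← hU, h, smul_sub, inv_smul_smul₀ hp.ne']
  rw [e, norm_smul, norm_inv, Real.norm_of_nonneg hp.le, inv_mul_eq_div]
  gcongr
  refine (norm_add_le _ _).trans ?_
  rw [norm_smul, Real.norm_eq_abs]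
  gcongr

theorem norm_pairAvg_le {T : Fin n → Example d} (hT : ∀ i j, ‖(T i).1 - (T j).1‖ ≤ R)
    (s : Finset (Fin n × Fin n)) : ‖pairAvg T s‖ ≤ R ^ 2 := by
  rw [pairAvg, norm_smul, norm_inv, Real.norm_natCast]
  rcases s.eq_empty_or_nonempty with rfl | hs
  · simpa using sq_nonneg R
  have hc : (0 : ℝ) < s.card := by exact_mod_cast hs.card_pos
  rw [inv_mul_le_iff₀ hc]
  calc _ ≤ ∑ p ∈ s, ‖outer ((T p.1).1 - (T p.2).1) ((T p.1).1 - (T p.2).1)‖ := norm_sum_le _ _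
    _ ≤ ∑ p ∈ s, R ^ 2 := Finset.sum_le_sum fun p _ => by
        rw [norm_outer, sq]
        exact mul_self_le_mul_self (norm_nonneg _) (hT _ _)
    _ = _ := by simp

theorem integrable_outer_sub (hu : Measurable u) (huR : ∀ z, ‖u z‖ ≤ R)
    (hux : ∀ᵐ z ∂D, u z = z.1 - x₀) :
    Integrable (fun p : Example d × Example d => outer (p.1.1 - p.2.1) (p.1.1 - p.2.1))
      (D.prod D) := by
  have h := integrable_pairs D (w := fun _ => 1) measurable_const hu (by simp) huR
  simp only [mul_one, one_smul] at h
  exact h.congr (outer_sub_ae_eq D hux)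

/-- The average over the sample pairs of one kind is close to the conditional expectation given
that kind; `ε = 1` for similar and `ε = -1` for dissimilar pairs. -/
theorem norm_pairAvg_sub_le (hn : 0 < n) {r : ℝ} (hr : 0 ≤ r) (hu : Measurable u) (hR : 0 ≤ R)
    (huR : ∀ z, ‖u z‖ ≤ R) (hux : ∀ᵐ z ∂D, u z = z.1 - x₀) {T : Fin n → Example d}
    (hTu : ∀ i, u (T i) = (T i).1 - x₀) (hT : ∀ i j, ‖(T i).1 - (T j).1‖ ≤ R)
    (hclose : MomentsClose D u R r T) {ε : ℝ} (hε : |ε| ≤ 1) {s : Finset (Fin n × Fin n)}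
    (hs : ∀ p, (if p ∈ s then (1 : ℝ) else 0) =
      (1 + ε * (labelVal (T p.1) * labelVal (T p.2))) / 2)
    {A : Set (Example d × Example d)} (hA : MeasurableSet A)
    (hAε : ∀ p, A.indicator (fun _ => (1 : ℝ)) p = (1 + ε * (labelVal p.1 * labelVal p.2)) / 2)
    (hpos : 0 < (D.prod D).real A) :
    ‖pairAvg T s - ((D.prod D).real A)⁻¹ •
      ∫ p in A, outer (p.1.1 - p.2.1) (p.1.1 - p.2.1) ∂(D.prod D)‖ ≤
      9 * (R ^ 2 * r) / (D.prod D).real A := by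
  have hn' : (0 : ℝ) < n := by exact_mod_cast hn
  set w : ℕ → Example d → ℝ := fun k z => labelVal z ^ k with hw
  have hwm : ∀ k, Measurable (w k) := fun k => measurable_labelVal.pow_const k
  have hw1 : ∀ k z, |w k z| ≤ 1 := fun k z => abs_labelVal_pow_le k z
  set q : ℕ → ℝ := fun k => empMean (w k) T
  set q' : ℕ → ℝ := fun k => ∫ z, w k z ∂D
  set V : ℕ → EuclideanSpace ℝ (Fin d × Fin d) := fun k => pairMoment (q k)
    (empMean (fun z => w k z • u z) T) (empMean (fun z => w k z • outer (u z) (u z)) T) with hV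
  set V' : ℕ → EuclideanSpace ℝ (Fin d × Fin d) := fun k => pairMoment (q' k)
    (∫ z, w k z • u z ∂D) (∫ z, w k z • outer (u z) (u z) ∂D) with hV'
  have hq1 : ∀ k, |q k| ≤ 1 := fun k => by
    simpa only [Real.norm_eq_abs] using
      norm_empMean_le (φ := w k) zero_le_one (fun z => (Real.norm_eq_abs _).trans_le (hw1 k z)) T
  have hVV : ∀ k : Fin 2, ‖V k - V' k‖ ≤ 8 * (R ^ 2 * r) := by
    intro k
    obtain ⟨c1, c2, c3⟩ := hclose k
    have hm : ∀ z, ‖w k z • u z‖ ≤ R := fun z => by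
      rw [norm_smul, ← one_mul R]
      exact mul_le_mul (hw1 k z) (huR z) (norm_nonneg _) zero_le_one
    have hS : ∀ z, ‖w k z • outer (u z) (u z)‖ ≤ R ^ 2 := fun z => by
      rw [norm_smul, norm_outer, ← one_mul (R ^ 2), sq]
      exact mul_le_mul (hw1 k z) (mul_self_le_mul_self (norm_nonneg _) (huR z)) (by positivity)
        zero_le_one
    exact norm_pairMoment_sub_le hR hr (hq1 k)
      (norm_empMean_le hR hm T) (norm_integral_le_of_bounded D hm)
      (norm_integral_le_of_bounded D hS) c1 c2 c3
  -- Multiplying by the empirical frequency clears the denominator, so the identity also holds for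
  -- empty `s`.
  have hemp : (s.card / (n : ℝ) ^ 2) • pairAvg T s = (1 / 2 : ℝ) • (V 0 + ε • V 1) := by
    simp only [hV, q]
    rw [← sum_pairs_eq_pairMoment, ← sum_pairs_eq_pairMoment, pairAvg, smul_smul]
    have hc : ((s.card : ℝ) / (n : ℝ) ^ 2 * (s.card : ℝ)⁻¹) •
        ∑ p ∈ s, outer ((T p.1).1 - (T p.2).1) ((T p.1).1 - (T p.2).1) =
        ((n : ℝ) ^ 2)⁻¹ • ∑ p ∈ s, outer ((T p.1).1 - (T p.2).1) ((T p.1).1 - (T p.2).1) := by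
      rcases s.eq_empty_or_nonempty with rfl | hne
      · simp
      · have : (s.card : ℝ) ≠ 0 := by exact_mod_cast hne.card_pos.ne'
        congr 1
        field_simp
    have hsum : ∑ p ∈ s, outer ((T p.1).1 - (T p.2).1) ((T p.1).1 - (T p.2).1) =
        ∑ p : Fin n × Fin n, ((1 + ε * (labelVal (T p.1) * labelVal (T p.2))) / 2) •
          outer (u (T p.1) - u (T p.2)) (u (T p.1) - u (T p.2)) := by
      simp only [← hs, ite_smul, one_smul, zero_smul, Finset.sum_ite_mem, Finset.univ_inter, hTu,
        sub_sub_sub_cancel_right]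
    rw [hc, hsum, smul_comm ε, ← smul_add, smul_comm (1 / 2 : ℝ)]
    congr 1
    rw [Finset.smul_sum, ← Finset.sum_add_distrib, Finset.smul_sum]
    refine Finset.sum_congr rfl fun p _ => ?_
    simp only [hw, pow_zero, pow_one, mul_one, one_smul]
    module
  have hcard : (s.card : ℝ) / (n : ℝ) ^ 2 = (1 + ε * q 1 ^ 2) / 2 := by
    simp only [q]
    rw [← sum_pairs_mul_eq_sq]
    have h1 : (s.card : ℝ) = ∑ p : Fin n × Fin n, if p ∈ s then (1 : ℝ) else 0 := by simp
    rw [h1]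
    simp only [hs, ← Finset.sum_div, Finset.sum_add_distrib, ← Finset.mul_sum, hw, pow_one]
    simp
    field_simp
  have hpopi : ∀ k, Integrable (fun p : Example d × Example d =>
      (w k p.1 * w k p.2) • outer (u p.1 - u p.2) (u p.1 - u p.2)) (D.prod D) := fun k =>
    integrable_pairs D (hwm k) hu (hw1 k) huR
  have hpopε : Integrable (fun p : Example d × Example d =>
      ε • (w 1 p.1 * w 1 p.2) • outer (u p.1 - u p.2) (u p.1 - u p.2)) (D.prod D) :=
    (hpopi 1).smul ε
  have hpop : ∫ p in A, outer (p.1.1 - p.2.1) (p.1.1 - p.2.1) ∂(D.prod D) =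
      (1 / 2 : ℝ) • (V' 0 + ε • V' 1) := by
    simp only [hV', q']
    rw [← integral_pairs_eq_pairMoment D (hwm 0) hu (hw1 0) huR,
      ← integral_pairs_eq_pairMoment D (hwm 1) hu (hw1 1) huR, ← integral_smul,
      ← integral_add (hpopi 0) hpopε, ← integral_smul, ← integral_indicator hA]
    refine integral_congr_ae ?_
    filter_upwards [outer_sub_ae_eq D hux] with p hp
    have : A.indicator (fun p => outer (p.1.1 - p.2.1) (p.1.1 - p.2.1)) p =
        A.indicator (fun _ => (1 : ℝ)) p • outer (p.1.1 - p.2.1) (p.1.1 - p.2.1) := by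
      by_cases h : p ∈ A <;> simp [h]
    rw [this, hAε, ← hp]
    simp only [hw, pow_zero, pow_one, mul_one, one_smul]
    module
  have hprob : (D.prod D).real A = (1 + ε * q' 1 ^ 2) / 2 := by
    have hi : Integrable (fun p : Example d × Example d => w 1 p.1 * w 1 p.2) (D.prod D) :=
      Integrable.mul_prod (integrable_of_bounded D (hwm 1) (hw1 1))
        (integrable_of_bounded D (hwm 1) (hw1 1))
    rw [← integral_indicator_one hA]
    have e : ∀ p, A.indicator (1 : Example d × Example d → ℝ) p =
        (1 + ε * (w 1 p.1 * w 1 p.2)) / 2 := fun p =>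
      (hAε p).trans (by simp only [hw, pow_one])
    simp only [e]
    rw [integral_div, integral_add (integrable_const _) (hi.const_mul ε), integral_const_mul,
      integral_prod_mul]
    simp [q', sq]
  have hU : ‖(1 / 2 : ℝ) • (V 0 + ε • V 1) - (1 / 2 : ℝ) • (V' 0 + ε • V' 1)‖ ≤
      8 * (R ^ 2 * r) := by
    have e : (1 / 2 : ℝ) • (V 0 + ε • V 1) - (1 / 2 : ℝ) • (V' 0 + ε • V' 1) =
        (1 / 2 : ℝ) • ((V 0 - V' 0) + ε • (V 1 - V' 1)) := by module
    rw [e, norm_smul, Real.norm_of_nonneg (by norm_num)]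
    have h0 : ‖V 0 - V' 0‖ ≤ 8 * (R ^ 2 * r) := hVV 0
    have h1 : ‖ε • (V 1 - V' 1)‖ ≤ 1 * (8 * (R ^ 2 * r)) := by
      rw [norm_smul]
      exact mul_le_mul hε (hVV 1) (norm_nonneg _) zero_le_one
    have := norm_add_le (V 0 - V' 0) (ε • (V 1 - V' 1))
    linarith
  have hpq : |(D.prod D).real A - s.card / (n : ℝ) ^ 2| ≤ r := by
    rw [hprob, hcard]
    have c1 : |q 1 - q' 1| ≤ r := (hclose 1).1
    have hq := hq1 1
    have hq' : |q' 1| ≤ 1 := by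
      simpa only [Real.norm_eq_abs] using norm_integral_le_of_bounded D (φ := w 1)
        (fun z => (Real.norm_eq_abs _).trans_le (hw1 1 z))
    have e : (1 + ε * q' 1 ^ 2) / 2 - (1 + ε * q 1 ^ 2) / 2 =
        -(ε * ((q 1 - q' 1) * ((q 1 + q' 1) / 2))) := by ring
    rw [e, abs_neg, abs_mul, abs_mul]
    have h2 : |(q 1 + q' 1) / 2| ≤ 1 := by
      rw [abs_le] at hq hq' ⊢
      constructor <;> linarith
    calc _ ≤ 1 * (r * 1) := by gcongr
      _ = r := by ring
  -- The constant `9` is `8` from the numerator plus `1` from the frequency.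
  refine (norm_sub_inv_smul_le hpos (norm_pairAvg_le hT s) (hemp.trans rfl)).trans ?_
  gcongr
  rw [hpop]
  have : |(D.prod D).real A - s.card / (n : ℝ) ^ 2| * R ^ 2 ≤ r * R ^ 2 := by gcongr
  linarith

end Labels

/-! ### From pair averages to risks -/

section Risk

variable {d n : ℕ}

/-- Since `2 / δ ≥ 2`, one has `log (2 / δ) ≥ 1 / 2` and `6 / δ ≤ (2 / δ) ^ 4`. The two terms cost
`2` and `2 * 2` multiples of the root. -/
theorem one_div_sqrt_add_le (hn : 0 < n) {δ : ℝ} (hδ : 0 < δ) (hδ1 : δ < 1) :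
    1 / √(n : ℝ) + 2 * √(Real.log (6 / δ) / (2 * n)) ≤ 6 * √(Real.log (2 / δ) / (2 * n)) := by
  have hn' : (0 : ℝ) < n := by exact_mod_cast hn
  have h2 : 2 ≤ 2 / δ := by rw [le_div_iff₀ hδ]; linarith
  have hlog : 1 / 2 ≤ Real.log (2 / δ) := by
    have := Real.log_le_log (by norm_num) h2
    linarith [Real.log_two_gt_d9]
  have h6 : Real.log (6 / δ) ≤ 4 * Real.log (2 / δ) := by
    rw [← Real.log_rpow (by positivity)]
    refine Real.log_le_log (by positivity) ?_
    have e : 6 / δ = 3 * (2 / δ) := by ring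
    rw [e]
    set t := 2 / δ
    norm_num
    have : t * 8 ≤ t * t ^ 3 := by gcongr; nlinarith [pow_le_pow_left₀ (by norm_num) h2 3]
    nlinarith
  have a1 : 1 / √(n : ℝ) ≤ 2 * √(Real.log (2 / δ) / (2 * n)) := by
    rw [show (2 : ℝ) = √4 by rw [show (4 : ℝ) = 2 ^ 2 by norm_num]; simp, ← Real.sqrt_one,
      ← Real.sqrt_div' _ hn'.le, ← Real.sqrt_mul (by norm_num)]
    refine Real.sqrt_le_sqrt ?_
    rw [show √(4 : ℝ) = 2 by rw [show (4 : ℝ) = 2 ^ 2 by norm_num]; simp,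
      ← mul_div_assoc, div_le_div_iff₀ hn' (by positivity)]
    nlinarith
  have a2 : √(Real.log (6 / δ) / (2 * n)) ≤ 2 * √(Real.log (2 / δ) / (2 * n)) := by
    calc _ ≤ √(2 ^ 2 * (Real.log (2 / δ) / (2 * n))) := by
          refine Real.sqrt_le_sqrt ?_
          rw [← mul_div_assoc]
          gcongr
          linarith
      _ = _ := by rw [Real.sqrt_mul (by norm_num), Real.sqrt_sq (by norm_num)]
  linarith

theorem norm_le_sqrt_add_norm {E : Type*} [SeminormedAddCommGroup E] {v w : E} {lam a : ℝ}
    (hlam : 0 < lam) (h : lam * ‖v - w‖ ^ 2 ≤ a) : ‖v‖ ≤ √(a / lam) + ‖w‖ := by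
  have h1 : ‖v - w‖ ≤ √(a / lam) := by
    refine Real.le_sqrt_of_sq_le ?_
    rw [le_div_iff₀ hlam]
    linarith
  linarith [norm_le_norm_sub_add v w]

/-- The conditional expectation of `(x - x')(x - x')ᵀ` given that the pair lies in `A`. -/
def pairExp (D : Measure (Example d)) (A : Set (Example d × Example d)) :
    EuclideanSpace ℝ (Fin d × Fin d) :=
  ((D.prod D).real A)⁻¹ • ∫ p in A, outer (p.1.1 - p.2.1) (p.1.1 - p.2.1) ∂(D.prod D)

theorem setIntegral_sqDist_div (D : Measure (Example d)) {A : Set (Example d × Example d)}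
    (hint : Integrable (fun p : Example d × Example d =>
      outer (p.1.1 - p.2.1) (p.1.1 - p.2.1)) (D.prod D)) (M : Matrix (Fin d) (Fin d) ℝ) :
    (∫ p in A, sqDist M p.1.1 p.2.1 ∂(D.prod D)) / (D.prod D).real A =
      inner ℝ (pairExp D A) (matVec M) := by
  have h := integral_inner (𝕜 := ℝ) (hint.restrict (s := A)) (matVec M)
  simp only [sqDist_eq_inner, pairExp, real_inner_smul_left]
  rw [real_inner_comm, ← h, div_eq_inv_mul]
  simp only [real_inner_comm]

theorem trueRisk_sub_empRisk_le (D : Measure (Example d)) (T : Fin n → Example d)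
    (hint : Integrable (fun p : Example d × Example d =>
      outer (p.1.1 - p.2.1) (p.1.1 - p.2.1)) (D.prod D)) {a c μ b : ℝ} (hμ : 0 ≤ μ)
    (hs : ‖pairAvg T (simPairs T) - pairExp D (simSet d)‖ ≤ a)
    (hd : ‖pairAvg T (disPairs T) - pairExp D (disSet d)‖ ≤ c) (M : Matrix (Fin d) (Fin d) ℝ) :
    trueRisk D μ b M - empRisk T μ b M ≤ (a + μ * c) * ‖M‖ := by
  have e : trueRisk D μ b M - empRisk T μ b M =
      inner ℝ (pairExp D (simSet d) - pairAvg T (simPairs T)) (matVec M) +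
        μ * inner ℝ (pairAvg T (disPairs T) - pairExp D (disSet d)) (matVec M) := by
    rw [trueRisk, empRisk, simProb, disProb, setIntegral_sqDist_div D hint,
      setIntegral_sqDist_div D hint, simAvg_eq_inner, disAvg_eq_inner, inner_sub_left,
      inner_sub_left]
    ring
  rw [norm_sub_rev] at hs
  have h1 := real_inner_le_norm (pairExp D (simSet d) - pairAvg T (simPairs T)) (matVec M)
  have h2 := real_inner_le_norm (pairAvg T (disPairs T) - pairExp D (disSet d)) (matVec M)
  rw [norm_matVec] at h1 h2
  rw [e, add_mul, mul_assoc]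
  gcongr
  · exact h1.trans (by gcongr)
  · exact h2.trans (by gcongr)

theorem indicator_simSet (p : Example d × Example d) :
    (simSet d).indicator (fun _ => (1 : ℝ)) p = (1 + 1 * (labelVal p.1 * labelVal p.2)) / 2 := by
  rw [← ite_label_eq]
  by_cases h : p.1.2 = p.2.2
  · rw [Set.indicator_of_mem (s := simSet d) h, if_pos h]
  · rw [Set.indicator_of_notMem (s := simSet d) h, if_neg h]

theorem indicator_disSet (p : Example d × Example d) :
    (disSet d).indicator (fun _ => (1 : ℝ)) p = (1 + -1 * (labelVal p.1 * labelVal p.2)) / 2 := by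
  rw [← ite_label_ne]
  by_cases h : p.1.2 ≠ p.2.2
  · rw [Set.indicator_of_mem (s := disSet d) h, if_pos h]
  · rw [Set.indicator_of_notMem (s := disSet d) h, if_neg h]

/-- The probability equals `(1 + (E y) ^ 2) / 2`, so it is never below `1 / 2`; only `disProb` needs
a positivity assumption. -/
theorem simProb_pos (D : Measure (Example d)) [IsProbabilityMeasure D] :
    0 < simProb D := by
  have hi : Integrable (fun z : Example d => labelVal z) D :=
    integrable_of_bounded D measurable_labelVal (B := 1) fun z => by
      simpa using abs_labelVal_pow_le 1 z
  have h : simProb D = (1 + (∫ z, labelVal z ∂D) ^ 2) / 2 := by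
    rw [simProb, ← integral_indicator_one measurableSet_simSet]
    have e : ∀ p, (simSet d).indicator (1 : Example d × Example d → ℝ) p =
        (1 + labelVal p.1 * labelVal p.2) / 2 := fun p =>
      (indicator_simSet p).trans (by rw [one_mul])
    simp only [e]
    rw [integral_div, integral_add (integrable_const _) (hi.mul_prod hi), integral_prod_mul]
    simp [sq]
  rw [h]
  positivity

end Risk

end

end MetricTransfer

/-! ### The generalization bound -/

theorem theorem2 :
    ∃ K C : ℝ, 0 < K ∧ 0 < C ∧
      ∀ (d n N : ℕ), 0 < n →
      ∀ (X : Set (EuclideanSpace ℝ (Fin d))), Bornology.IsBounded X →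
      ∀ (D : Measure (Example d)) [IsProbabilityMeasure D],
        (∀ᵐ z ∂D, z.1 ∈ X) → 0 < disProb D →
      ∀ (Ms : Fin N → Matrix (Fin d) (Fin d) ℝ), (∀ j, (Ms j).PosSemidef) →
      ∀ (lam b δ : ℝ), 0 < lam → 0 < δ → δ < 1 →
        Measure.pi (fun _ : Fin n => D)
          {T : Fin n → Example d |
            ¬ ∀ (β : EuclideanSpace ℝ (Fin N)) (M : Matrix (Fin d) (Fin d) ℝ) (μ : ℝ),
                IsLearned T Ms lam b β M → IsOptimalDual T Ms lam b β μ →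
                0 ≤ empRisk T μ b (weighted Ms β) ∧
                trueRisk D μ b M ≤
                  empRisk T μ b M + K * (lipConst D X μ ^ 2 / lam) / (n : ℝ) +
                    C * admConst D X μ *
                      (√(empRisk T μ b (weighted Ms β) / lam) + ‖weighted Ms β‖) *
                      √(Real.log (2 / δ) / (2 * (n : ℝ)))}
          ≤ ENNReal.ofReal δ := by
  -- `54 = 9 * 6`, from `norm_pairAvg_sub_le` and `one_div_sqrt_add_le`; any positive `K` would do.
  refine ⟨1, 54, one_pos, by norm_num, ?_⟩
  intro d n N hn X hXb D _ hX hdis Ms hMs lam b δ hlam hδ hδ1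
  have hn' : (0 : ℝ) < n := by exact_mod_cast hn
  obtain ⟨z₀, hz₀⟩ := hX.exists
  set x₀ := z₀.1
  set R := Metric.diam X with hRdef
  have hR : 0 ≤ R := Metric.diam_nonneg
  have hXR : ∀ x ∈ X, ∀ y ∈ X, ‖x - y‖ ≤ R := fun x hx y hy => by
    rw [← dist_eq_norm]
    exact Metric.dist_le_diam_of_mem hXb hx hy
  -- Centring at a point of `X` bounds the features by the diameter, and differences do not see the
  -- shift. Truncation by the norm keeps `u` measurable and bounded everywhere, although `X` itself
  -- need not be measurable.
  set u : Example d → EuclideanSpace ℝ (Fin d) :=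
    fun z => if ‖z.1 - x₀‖ ≤ R then z.1 - x₀ else 0 with hu_def
  have hu : Measurable u :=
    Measurable.ite (measurableSet_le (by fun_prop) measurable_const) (by fun_prop)
      measurable_const
  have huR : ∀ z, ‖u z‖ ≤ R := fun z => by
    by_cases h : ‖z.1 - x₀‖ ≤ R
    · simp [hu_def, h]
    · simpa [hu_def, h] using hR
  have huX : ∀ z : Example d, z.1 ∈ X → u z = z.1 - x₀ := fun z hz => by
    simp [hu_def, hXR _ hz _ hz₀]
  have hux : ∀ᵐ z ∂D, u z = z.1 - x₀ := hX.mono huX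
  have hsim := simProb_pos D
  -- Each of the six events gets probability `exp (-L) = δ / 6`.
  set L := Real.log (6 / δ) with hL
  have hL0 : 0 ≤ L := Real.log_nonneg (by rw [le_div_iff₀ hδ]; linarith)
  set r := 1 / √(n : ℝ) + 2 * √(L / (2 * n)) with hr
  have hr0 : 0 ≤ r := by positivity
  have hrle : r ≤ 6 * √(Real.log (2 / δ) / (2 * n)) := one_div_sqrt_add_le hn hδ hδ1
  have hnull : (Measure.pi fun _ : Fin n => D) {T | ¬ ∀ i, (T i).1 ∈ X} = 0 :=
    ae_all_iff.2 fun i =>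
      (measurePreserving_eval (fun _ : Fin n => D) i).quasiMeasurePreserving.ae hX
  have hconc := measure_not_momentsClose_le D hn hu hR huR hL0
  have hexp : 6 * Real.exp (-L) = δ := by
    rw [Real.exp_neg, hL, Real.exp_log (by positivity)]
    field_simp
  rw [hexp] at hconc
  calc _ ≤ (Measure.pi fun _ : Fin n => D)
        ({T | ¬ ∀ i, (T i).1 ∈ X} ∪ {T | ¬ MomentsClose D u R r T}) := measure_mono ?_
    _ ≤ 0 + ENNReal.ofReal δ := (measure_union_le _ _).trans (add_le_add hnull.le hconc)
    _ = _ := zero_add _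
  intro T hT
  by_contra hgood
  simp only [Set.mem_union, Set.mem_ofPred_eq, not_or, not_not] at hgood
  obtain ⟨hTX, hclose⟩ := hgood
  -- From here on the sample is fixed and the argument is deterministic, hence simultaneous in `β`,
  -- `M` and `μ`.
  refine hT fun β M μ hM hμ => ?_
  have hTR : ∀ i j, ‖(T i).1 - (T j).1‖ ≤ R := fun i j => hXR _ (hTX i) _ (hTX j)
  have hkey := lam_mul_sq_norm_sub_le_empRisk hMs hlam hM hμ
  have hemp : 0 ≤ empRisk T μ b (weighted Ms β) := le_trans (by positivity) hkey
  refine ⟨hemp, ?_⟩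
  have hS := norm_pairAvg_sub_le D hn hr0 hu hR huR hux (fun i => huX _ (hTX i)) hTR hclose
    (ε := 1) (by simp) (s := simPairs T)
    (fun p => by simpa [simPairs] using ite_label_eq (T p.1) (T p.2))
    measurableSet_simSet indicator_simSet hsim
  have hD := norm_pairAvg_sub_le D hn hr0 hu hR huR hux (fun i => huX _ (hTX i)) hTR hclose
    (ε := -1) (by simp) (s := disPairs T)
    (fun p => by simpa [disPairs] using ite_label_ne (T p.1) (T p.2))
    measurableSet_disSet indicator_disSet hdis
  have hμ0 := hμ.1
  have hrisk := trueRisk_sub_empRisk_le D T (integrable_outer_sub D hu huR hux) (b := b) hμ0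
    hS hD M
  have hMnorm := norm_le_sqrt_add_norm hlam hkey
  have hadm : 9 * (R ^ 2 * r) / simProb D + μ * (9 * (R ^ 2 * r) / disProb D) =
      9 * admConst D X μ * r := by
    rw [admConst]
    ring
  have hadm0 : 0 ≤ admConst D X μ := by
    rw [admConst]
    positivity
  have hK : 0 ≤ 1 * (lipConst D X μ ^ 2 / lam) / (n : ℝ) := by positivity
  change _ ≤ (9 * (R ^ 2 * r) / simProb D + μ * (9 * (R ^ 2 * r) / disProb D)) * ‖M‖ at hrisk
  rw [hadm] at hrisk
  have hfin : 9 * admConst D X μ * r * ‖M‖ ≤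
      54 * admConst D X μ * (√(empRisk T μ b (weighted Ms β) / lam) + ‖weighted Ms β‖) *
        √(Real.log (2 / δ) / (2 * (n : ℝ))) := by
    calc _ ≤ 9 * admConst D X μ * (6 * √(Real.log (2 / δ) / (2 * n))) *
          (√(empRisk T μ b (weighted Ms β) / lam) + ‖weighted Ms β‖) := by gcongr
      _ = _ := by ring
  linarith
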